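/- Let $n\ge 1$, let $\sigma$ denote the spherical Lebesgue measure on $S^{n-1}\subset\mathbb{R}^n$, let $\omega_i$ denote the surface area of the unit ball of $\mathbb{R}^i$ ($\omega_i=i\kappa_i$ with $\kappa_i$ the volume of this ball; in particular $\omega_0=0$, $\omega_1=2$), and let $B_r$ denote the closed ball of radius $r$ centred at the origin. For a convex body $L\subset\mathbb{R}^n$ (a compact convex set with non-empty interior) let $h_L(u)=\max_{x\in L}x\cdot u$ be its support function, $D(L)$ its diameter, and $$\mathcal{E}_{-1}(L)=\frac{1}{\omega_n}\inf_{x\in\operatorname{int}L}\int_{S^{n-1}} h_{L-x}^{-1}\,d\sigma .$$ For convex bodies $L,M$ put $\delta_2(L,M)=\left(\frac{1}{\omega_n}\int_{S^{n-1}}|h_L-h_M|^2\,d\sigma\right)^{1/2}$. Let $K\subset\mathbb{R}^n$ be an origin-symmetric convex body ($K=-K$), and let $\tilde K=cK$, $c>0$, be its dilation with the volume of the unit ball. Suppose that $\mathcal{E}_{-1}(\tilde K)\ge 1-\varepsilon$ for some $\varepsilon\in(0,1)$. Then there exists $r$ with $1\le r\le (1-\varepsilon)^{-1}$ such that $$\delta_2(\tilde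 K,B_r)\le D(\tilde K)\sqrt{\varepsilon}.$$ Moreover, $$\left(\tfrac12 D(\tilde K)\right)^{1/3}\le\left(1+\left(\frac{4\omega_{n-1}}{\omega_n}\right)^{1/2}\right)\frac{1}{1-\varepsilon}.$$ -/

import Mathlib

open MeasureTheory
open scoped Pointwise

noncomputable section

namespace LpStability

/-- The support function `h_K(u) = max_{x ∈ K} x · u` of a set `K ⊆ ℝⁿ`
(the supremum is attained for nonempty compact `K`). -/
def supportFun {n : ℕ} (K : Set (EuclideanSpace ℝ (Fin n))) (u : EuclideanSpace ℝ (Fin n)) : ℝ :=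
  sSup ((fun x => inner ℝ x u) '' K)

/-- The spherical Lebesgue measure `σ` on the unit sphere of `ℝⁿ`. -/
def sphereMeasure (n : ℕ) : Measure (Metric.sphere (0 : EuclideanSpace ℝ (Fin n)) 1) :=
  (volume : Measure (EuclideanSpace ℝ (Fin n))).toSphere

/-- `ω_n = ∫ dσ`, the surface area of the unit ball of `ℝⁿ`. -/
def omega (n : ℕ) : ℝ := (sphereMeasure n).real Set.univ

/-- `κ_n`, the volume of the unit ball of `ℝⁿ`. -/
def kappa (n : ℕ) : ℝ :=
  (volume : Measure (EuclideanSpace ℝ (Fin n))).real (Metric.closedBall 0 1)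

/-- The dilation `K̃` of `K` that has the volume of the unit ball (see `volume_normalize`). -/
def normalize {n : ℕ} (K : Set (EuclideanSpace ℝ (Fin n))) : Set (EuclideanSpace ℝ (Fin n)) :=
  ((kappa n / volume.real K) ^ (1 / (n : ℝ))) • K

theorem volume_normalize {n : ℕ} (hn : 1 ≤ n) (K : ConvexBody (EuclideanSpace ℝ (Fin n)))
    (hK : (interior (K : Set (EuclideanSpace ℝ (Fin n)))).Nonempty) :
    volume.real (normalize (K : Set (EuclideanSpace ℝ (Fin n)))) = kappa n := by
  have hpos : 0 < volume.real (K : Set (EuclideanSpace ℝ (Fin n))) :=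
    ENNReal.toReal_pos
      (Measure.measure_pos_of_nonempty_interior _ hK).ne' K.isCompact.measure_lt_top.ne
  have hk : 0 ≤ kappa n := measureReal_nonneg
  have hn0 : (n : ℝ) ≠ 0 := by positivity
  rw [normalize, Measure.real, Measure.addHaar_smul, ENNReal.toReal_mul, finrank_euclideanSpace,
    Fintype.card_fin, ENNReal.toReal_ofReal (abs_nonneg _), abs_of_nonneg (by positivity),
    ← Real.rpow_natCast, ← Real.rpow_mul (by positivity), one_div, inv_mul_cancel₀ hn0,
    Real.rpow_one]
  exact div_mul_cancel₀ _ hpos.ne'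

/-- The `L_p`-width for negative exponents `-n ≤ p < 0`:
`ℰ_p(K) = (1/ω_n) inf_{x ∈ int K} ∫ h_{K-x}^p dσ`. -/
def lpWidth {n : ℕ} (p : ℝ) (K : Set (EuclideanSpace ℝ (Fin n))) : ℝ :=
  (1 / omega n) * sInf ((fun x : EuclideanSpace ℝ (Fin n) =>
    ∫ u, supportFun ((fun y => y - x) '' K) u ^ p ∂(sphereMeasure n)) '' interior K)

/-- The `L²`-distance `δ₂(K, L) = ((1/ω_n) ∫ |h_K - h_L|² dσ)^{1/2}`. -/
def deltaTwo {n : ℕ} (K L : Set (EuclideanSpace ℝ (Fin n))) : ℝ :=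
  Real.sqrt ((1 / omega n) * ∫ u, |supportFun K u - supportFun L u| ^ 2 ∂(sphereMeasure n))

end LpStability

end

namespace LpStability

open Set Filter ENNReal

/-! Let `h` be the support function of the normalized body. Both estimates follow from `∫ h⁻¹ ≥ (1 -
ε) ω_n`, which is the width hypothesis tested at the centre, together with `∫ h⁻² ≤ ω_n`. By these
bounds `∫ (1 - h⁻¹)² ≤ 2 ε ω_n`. Since `|h - 1| = h |1 - h⁻¹|` and `h ≤ D / 2` on the sphere, this
bounds the distance to the unit ball, so `r = 1` always works. For the diameter, put `H = D / 2`.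
The body contains a segment `[-H e, H e]`, so `h ≥ H |⟪e, u⟫|` and `h⁻¹` is small off a thin band
around the equator of `e`. The band has small measure and `∫ h⁻²` is bounded, so a long body would
make `∫ h⁻¹` too small.

The bound on `∫ h⁻²` is Blaschke–Santaló: the volume of the polar body is `(1 / n) ∫ h⁻ⁿ`, hence `∫
h⁻ⁿ ≤ ω_n`. Power means descend to exponent 2 when `n ≥ 2`, and `n = 1` is direct.

Blaschke–Santaló is deduced from its functional form, `functionalSantalo`, applied to `exp (-p²)`
and `exp (-q²)` for the gauge `p` and the support function `q`. That form is proved by Lehec's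
induction on dimension: a hyperplane halves the mass of one function, a shear centres both halves,
and each half is handled by one-dimensional Prékopa–Leindler across the hyperplane and the inductive
hypothesis along it. -/

/-! ### One-dimensional Brunn–Minkowski and Prékopa–Leindler inequalities. -/

/-- One-dimensional Brunn–Minkowski inequality for compact sets. -/
theorem volume_add_volume_le_of_isCompact {A B : Set ℝ} (hA : IsCompact A) (hB : IsCompact B)
    (hA' : A.Nonempty) (hB' : B.Nonempty) : volume A + volume B ≤ volume (A + B) := by
  obtain ⟨a, ha, hamax⟩ := hA.exists_isGreatest hA'
  obtain ⟨b, hb, hbmin⟩ := hB.exists_isLeast hB'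
  have h1 : volume ((fun x => b + x) '' A) = volume A := by
    simp
  have h2 : volume ((fun x => a + x) '' B) = volume B := by
    simp
  -- With `a = max A` and `b = min B`, the translates `b + A` and `a + B` lie in `A + B` on opposite
  -- sides of `a + b`, and can meet only there.
  have hdisj : AEDisjoint volume ((fun x => b + x) '' A) ((fun x => a + x) '' B) := by
    refine measure_mono_null (t := {a + b}) ?_ (by simp)
    rintro _ ⟨⟨x, hx, rfl⟩, ⟨y, hy, hxy⟩⟩
    have := hamax hx
    have := hbmin hy
    simp only [mem_singleton_iff] at *
    linarith
  rw [← h1, ← h2, ← measure_union₀ _ hdisj]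
  · refine measure_mono (union_subset ?_ ?_)
    · rintro _ ⟨x, hx, rfl⟩
      exact ⟨x, hx, b, hb, add_comm _ _⟩
    · rintro _ ⟨x, hx, rfl⟩
      exact ⟨a, ha, x, hx, rfl⟩
  · exact (hB.image (by fun_prop)).measurableSet.nullMeasurableSet

/-- One-dimensional Brunn–Minkowski inequality. -/
theorem volume_add_volume_le {A B : Set ℝ} (hA : MeasurableSet A) (hB : MeasurableSet B)
    (hA' : A.Nonempty) (hB' : B.Nonempty) : volume A + volume B ≤ volume (A + B) := by
  obtain ⟨a₀, ha₀⟩ := hA'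
  obtain ⟨b₀, hb₀⟩ := hB'
  have key : ∀ K ⊆ A, IsCompact K → ∀ K' ⊆ B, IsCompact K' →
      volume K + volume K' ≤ volume (A + B) := by
    intro K hK hKc K' hK' hKc'
    -- The compact subsets may be empty; adjoining a fixed point of `A` and of `B` makes the compact
    -- case applicable.
    calc volume K + volume K' ≤ volume (insert a₀ K) + volume (insert b₀ K') := by
          gcongr <;> exact subset_insert _ _
      _ ≤ volume (insert a₀ K + insert b₀ K') :=
          volume_add_volume_le_of_isCompact (hKc.insert _) (hKc'.insert _)
            (insert_nonempty _ _) (insert_nonempty _ _)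
      _ ≤ volume (A + B) := measure_mono
          (add_subset_add (insert_subset ha₀ hK) (insert_subset hb₀ hK'))
  rw [hA.measure_eq_iSup_isCompact, hB.measure_eq_iSup_isCompact]
  simp only [iSup_and']
  exact ENNReal.biSup_add_biSup_le' ⟨∅, empty_subset _, isCompact_empty⟩
    ⟨∅, empty_subset _, isCompact_empty⟩ fun K hK K' hK' => key K hK.1 hK.2 K' hK'.1 hK'.2

/-- Normalized form of the one-dimensional Prékopa–Leindler inequality. -/
theorem lintegral_add_lintegral_le_of_normalized {φ ψ η : ℝ → ℝ} (hφ : Measurable φ)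
    (hψ : Measurable ψ) (hη : Measurable η) (hφ0 : 0 ≤ φ) (hψ0 : 0 ≤ ψ) (hη0 : 0 ≤ η)
    (hφ1 : ∀ x, φ x ≤ 1) (hψ1 : ∀ x, ψ x ≤ 1)
    (hφs : ∀ t < 1, ∃ x, t < φ x) (hψs : ∀ t < 1, ∃ x, t < ψ x)
    (h : ∀ x y, φ x * ψ y ≤ η ((x + y) / 2) ^ 2) :
    (∫⁻ x, .ofReal (φ x)) + ∫⁻ x, .ofReal (ψ x) ≤ 2 * ∫⁻ x, .ofReal (η x) := by
  rw [lintegral_eq_lintegral_meas_lt _ (.of_forall hφ0) hφ.aemeasurable,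
    lintegral_eq_lintegral_meas_lt _ (.of_forall hψ0) hψ.aemeasurable,
    lintegral_eq_lintegral_meas_lt _ (.of_forall hη0) hη.aemeasurable,
    ← lintegral_const_mul' _ _ (by simp), ← lintegral_add_left]
  swap
  · exact (Antitone.measurable fun s t hst => measure_mono fun x hx => lt_of_le_of_lt hst hx)
  refine setLIntegral_mono' measurableSet_Ioi fun t (ht : 0 < t) => ?_
  -- Layer by layer: for `t < 1` both superlevel sets are nonempty, so Brunn–Minkowski applies to
  -- them; for `t ≥ 1` both are empty. This is why the two suprema are normalized to the same value.
  rcases lt_or_ge t 1 with ht1 | ht1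
  · have hsub : {x | t < φ x} + {x | t < ψ x} ⊆ (fun z => (2 : ℝ)⁻¹ • z) ⁻¹' {x | t < η x} := by
      rintro _ ⟨x, hx, y, hy, rfl⟩
      have h1 := h x y
      have : t * t < φ x * ψ y := mul_lt_mul'' hx hy ht.le ht.le
      have h2 : t ^ 2 < η ((x + y) / 2) ^ 2 := by nlinarith
      have h3 := lt_of_pow_lt_pow_left₀ 2 (hη0 _) h2
      rwa [div_eq_inv_mul] at h3
    calc volume {x | t < φ x} + volume {x | t < ψ x}
        ≤ volume ({x | t < φ x} + {x | t < ψ x}) :=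
          volume_add_volume_le (hφ measurableSet_Ioi) (hψ measurableSet_Ioi) (hφs t ht1) (hψs t ht1)
      _ ≤ volume ((fun z => (2 : ℝ)⁻¹ • z) ⁻¹' {x | t < η x}) := measure_mono hsub
      _ = 2 * volume {x | t < η x} := by
          rw [Measure.addHaar_preimage_smul _ (by norm_num)]
          simp
  · have h1 : {x | t < φ x} = ∅ := by
      ext x; simpa using (hφ1 x).trans ht1
    have h2 : {x | t < ψ x} = ∅ := by
      ext x; simpa using (hψ1 x).trans ht1
    simp [h1, h2]

/-- AM–GM, which turns the additive inequality for normalized functions into the multiplicative one.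
-/
theorem four_mul_mul_le_sq_add (a b : ℝ≥0∞) : 4 * (a * b) ≤ (a + b) ^ 2 := by
  rcases eq_or_ne a ∞ with rfl | ha
  · simp
  rcases eq_or_ne b ∞ with rfl | hb
  · simp
  lift a to NNReal using ha
  lift b to NNReal using hb
  norm_cast
  rw [← NNReal.coe_le_coe]
  push_cast
  nlinarith [sq_nonneg ((a : ℝ) - b)]

/-- One-dimensional Prékopa–Leindler inequality for bounded functions. -/
theorem lintegral_mul_lintegral_le_of_bounded {φ ψ : ℝ → ℝ≥0∞} {η : ℝ → ℝ} (hφ : Measurable φ)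
    (hψ : Measurable ψ) (hη : Measurable η) (hη0 : 0 ≤ η)
    {N : ℝ≥0∞} (hN : N ≠ ∞) (hφN : ∀ x, φ x ≤ N) (hψN : ∀ x, ψ x ≤ N)
    (h : ∀ x y, φ x * ψ y ≤ .ofReal (η ((x + y) / 2) ^ 2)) :
    (∫⁻ x, φ x) * ∫⁻ x, ψ x ≤ (∫⁻ x, .ofReal (η x)) ^ 2 := by
  set P := ⨆ x, φ x with hP
  set Q := ⨆ x, ψ x with hQ
  have hPt : P ≠ ∞ := ne_top_of_le_ne_top hN (iSup_le hφN)
  have hQt : Q ≠ ∞ := ne_top_of_le_ne_top hN (iSup_le hψN)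
  rcases eq_or_ne P 0 with hP0 | hP0
  · have : ∀ x, φ x = 0 := fun x => le_antisymm (hP0 ▸ le_iSup φ x) zero_le
    simp [this]
  rcases eq_or_ne Q 0 with hQ0 | hQ0
  · have : ∀ x, ψ x = 0 := fun x => le_antisymm (hQ0 ▸ le_iSup ψ x) zero_le
    simp [this]
  have hp : 0 < P.toReal := toReal_pos hP0 hPt
  have hq : 0 < Q.toReal := toReal_pos hQ0 hQt
  have hφt : ∀ x, φ x ≠ ∞ := fun x => ne_top_of_le_ne_top hN (hφN x)
  have hψt : ∀ x, ψ x ≠ ∞ := fun x => ne_top_of_le_ne_top hN (hψN x)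
  -- Dividing `φ`, `ψ` by their suprema and `η` by the geometric mean of these preserves the
  -- pointwise hypothesis.
  set c := Real.sqrt (P.toReal * Q.toReal) with hc
  have hc0 : 0 < c := Real.sqrt_pos.2 (by positivity)
  have hc2 : c ^ 2 = P.toReal * Q.toReal := Real.sq_sqrt (by positivity)
  have key := lintegral_add_lintegral_le_of_normalized (φ := fun x => (φ x).toReal / P.toReal)
    (ψ := fun x => (ψ x).toReal / Q.toReal) (η := fun x => η x / c)
    (by fun_prop) (by fun_prop) (by fun_prop)
    (fun x => by positivity) (fun x => by positivity) (fun x => div_nonneg (hη0 x) hc0.le)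
    (fun x => div_le_one_of_le₀ (toReal_mono hPt (le_iSup φ x)) hp.le)
    (fun x => div_le_one_of_le₀ (toReal_mono hQt (le_iSup ψ x)) hq.le) ?_ ?_ ?_
  · have e1 : (∫⁻ x, .ofReal ((φ x).toReal / P.toReal)) = (∫⁻ x, φ x) * P⁻¹ := by
      rw [← lintegral_mul_const' _ _ (by simpa using hP0)]
      congr with x
      rw [ofReal_div_of_pos hp, ofReal_toReal (hφt x), ofReal_toReal hPt, div_eq_mul_inv]
    have e2 : (∫⁻ x, .ofReal ((ψ x).toReal / Q.toReal)) = (∫⁻ x, ψ x) * Q⁻¹ := by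
      rw [← lintegral_mul_const' _ _ (by simpa using hQ0)]
      congr with x
      rw [ofReal_div_of_pos hq, ofReal_toReal (hψt x), ofReal_toReal hQt, div_eq_mul_inv]
    have e3 : (∫⁻ x, .ofReal (η x / c)) = (∫⁻ x, .ofReal (η x)) * (ENNReal.ofReal c)⁻¹ := by
      rw [← lintegral_mul_const' _ _ (by simpa using hc0)]
      congr with x
      rw [ofReal_div_of_pos hc0, div_eq_mul_inv]
    rw [e1, e2, e3] at key
    have k2 := (four_mul_mul_le_sq_add _ _).trans (pow_le_pow_left' key 2)
    have hcc : (ENNReal.ofReal c)⁻¹ ^ 2 = P⁻¹ * Q⁻¹ := by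
      rw [← ENNReal.inv_pow, ← ofReal_pow hc0.le, hc2, ofReal_mul hp.le, ofReal_toReal hPt,
        ofReal_toReal hQt, ENNReal.mul_inv (.inl hP0) (.inl hPt)]
    have k3 : (4 * (P⁻¹ * Q⁻¹)) * ((∫⁻ x, φ x) * ∫⁻ x, ψ x)
        ≤ (4 * (P⁻¹ * Q⁻¹)) * (∫⁻ x, .ofReal (η x)) ^ 2 := by
      rw [mul_pow, mul_pow, hcc] at k2
      calc _ = 4 * ((∫⁻ x, φ x) * P⁻¹ * ((∫⁻ x, ψ x) * Q⁻¹)) := by ring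
        _ ≤ _ := k2
        _ = _ := by ring
    refine (ENNReal.mul_le_mul_iff_right ?_ ?_).1 k3
    · simp [hPt, hQt]
    · finiteness
  · intro t ht
    have : ENNReal.ofReal (t * P.toReal) < P := by
      rw [← ofReal_toReal hPt, ofReal_lt_ofReal_iff hp, toReal_ofReal hp.le]
      nlinarith
    obtain ⟨x, hx⟩ := lt_iSup_iff.1 this
    refine ⟨x, ?_⟩
    rw [← ofReal_toReal (hφt x)] at hx
    rw [lt_div_iff₀ hp]
    exact (ofReal_lt_ofReal_iff').1 hx |>.1
  · intro t ht
    have : ENNReal.ofReal (t * Q.toReal) < Q := by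
      rw [← ofReal_toReal hQt, ofReal_lt_ofReal_iff hq, toReal_ofReal hq.le]
      nlinarith
    obtain ⟨x, hx⟩ := lt_iSup_iff.1 this
    refine ⟨x, ?_⟩
    rw [← ofReal_toReal (hψt x)] at hx
    rw [lt_div_iff₀ hq]
    exact (ofReal_lt_ofReal_iff').1 hx |>.1
  · intro x y
    have h1 := toReal_mono (by finiteness) (h x y)
    rw [toReal_mul, toReal_ofReal (by positivity)] at h1
    rw [div_mul_div_comm, div_pow, hc2]
    gcongr

/-- One-dimensional Prékopa–Leindler inequality. -/
theorem lintegral_mul_lintegral_le_sq {φ ψ : ℝ → ℝ≥0∞} {η : ℝ → ℝ} (hφ : Measurable φ)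
    (hψ : Measurable ψ) (hη : Measurable η) (hη0 : 0 ≤ η)
    (h : ∀ x y, φ x * ψ y ≤ .ofReal (η ((x + y) / 2) ^ 2)) :
    (∫⁻ x, φ x) * ∫⁻ x, ψ x ≤ (∫⁻ x, .ofReal (η x)) ^ 2 := by
  have trunc : ∀ f : ℝ → ℝ≥0∞, Measurable f →
      ∫⁻ x, f x = ⨆ N : ℕ, ∫⁻ x, min (f x) N := by
    intro f hf
    rw [← lintegral_iSup (f := fun (N : ℕ) x => min (f x) N) (fun N => hf.min measurable_const)
      (fun M N hMN x => min_le_min_left _ (by exact_mod_cast hMN))]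
    congr with x
    rw [← inf_iSup_eq, ENNReal.iSup_natCast, inf_top_eq]
  rw [trunc φ hφ, trunc ψ hψ, ENNReal.iSup_mul]
  refine iSup_le fun M => ?_
  rw [ENNReal.mul_iSup]
  refine iSup_le fun N => ?_
  refine lintegral_mul_lintegral_le_of_bounded (N := max M N)
    (hφ.min measurable_const) (hψ.min measurable_const) hη hη0
    (by simp) (fun x => (min_le_right _ _).trans (le_max_left _ _))
    (fun x => (min_le_right _ _).trans (le_max_right _ _)) fun x y => (h x y).trans' ?_
  gcongr <;> exact min_le_left _ _

/-! ### The functional Santaló inequality, by induction on the dimension. -/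

theorem lintegral_Ioi_eq_lintegral_exp (f : ℝ → ℝ≥0∞) :
    ∫⁻ s in Ioi 0, f s = ∫⁻ a, f (Real.exp a) * .ofReal (Real.exp a) := by
  have := lintegral_image_eq_lintegral_abs_deriv_mul (s := univ) MeasurableSet.univ
    (fun x _ => (Real.hasDerivAt_exp x).hasDerivWithinAt) Real.exp_injective.injOn f
  rw [image_univ, Real.range_exp, setLIntegral_univ] at this
  rw [this]
  congr with a
  rw [abs_of_pos (Real.exp_pos a), mul_comm]

/-- The half-line case of the functional Santaló inequality. -/
theorem lintegral_Ioi_mul_lintegral_Ioi_le {φ ψ : ℝ → ℝ≥0∞} (hφ : Measurable φ)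
    (hψ : Measurable ψ) {c : ℝ}
    (h : ∀ s t, 0 < s → 0 < t → φ s * ψ t ≤ .ofReal (Real.exp (-2 * (c + s * t)))) :
    (∫⁻ s in Ioi 0, φ s) * ∫⁻ t in Ioi 0, ψ t ≤ .ofReal (Real.pi / 4 * Real.exp (-2 * c)) := by
  rw [lintegral_Ioi_eq_lintegral_exp φ, lintegral_Ioi_eq_lintegral_exp ψ]
  -- In the variables `s = exp a`, `t = exp b`, the midpoint of `a` and `b` corresponds to `√(s t)`,
  -- so `exp (-(c + s t))` is a Gaussian evaluated at the midpoint. Its half-line integral, squared,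
  -- gives `π / 4 * exp (-2 c)`.
  set G : ℝ → ℝ := fun s => Real.exp (-c) * Real.exp (-1 * s ^ 2) with hG
  have key := lintegral_mul_lintegral_le_sq
    (φ := fun a => φ (Real.exp a) * .ofReal (Real.exp a))
    (ψ := fun a => ψ (Real.exp a) * .ofReal (Real.exp a))
    (η := fun a => G (Real.exp a) * Real.exp a)
    (by fun_prop) (by fun_prop) (by fun_prop) (fun a => by positivity) ?_
  · refine key.trans_eq ?_
    have : ∫⁻ a, ENNReal.ofReal (G (Real.exp a) * Real.exp a) = ∫⁻ s in Ioi 0, .ofReal (G s) := by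
      rw [lintegral_Ioi_eq_lintegral_exp]
      congr with a
      rw [ofReal_mul (by positivity)]
    rw [this, ← ofReal_integral_eq_lintegral_ofReal, integral_const_mul, integral_gaussian_Ioi,
      ← ofReal_pow (by positivity), mul_pow, div_pow, Real.sq_sqrt (by positivity), ← Real.exp_nat_mul]
    · congr 1
      push_cast
      ring_nf
    · exact ((integrable_exp_neg_mul_sq one_pos).const_mul _).integrableOn
    · exact .of_forall fun s => by positivity
  · intro a b
    calc _ = (φ (Real.exp a) * ψ (Real.exp b)) * .ofReal (Real.exp a * Real.exp b) := by
          rw [ofReal_mul (by positivity)]; ring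
      _ ≤ .ofReal (Real.exp (-2 * (c + Real.exp a * Real.exp b)))
            * .ofReal (Real.exp a * Real.exp b) := by
          gcongr
          exact h _ _ (Real.exp_pos a) (Real.exp_pos b)
      _ = _ := by
          rw [← ofReal_mul (by positivity)]
          congr 1
          simp only [hG, ← Real.exp_add, ← Real.exp_nat_mul]
          congr 1
          push_cast
          ring_nf

/-- The functional Santaló inequality in dimension `n` for centred functions: the mass of `f` is
not decreased by any exponential tilt. -/
def FunctionalSantalo (n : ℕ) : Prop :=
  ∀ f g : (Fin n → ℝ) → ℝ≥0∞, Measurable f → Measurable g →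
    (∀ z, ∫⁻ x, f x ≤ ∫⁻ x, f x * .ofReal (Real.exp (z ⬝ᵥ x))) →
    (∀ x y, f x * g y ≤ .ofReal (Real.exp (-2 * (x ⬝ᵥ y)))) →
    (∫⁻ x, f x) * ∫⁻ x, g x ≤ .ofReal (Real.pi ^ n)

/-- Integrating out the normal variable with the half-line inequality leaves marginals whose product
is at most `π / 4 * exp (-2 (x ⬝ᵥ y))`. After rescaling one of them by `4 / π`, the inductive
hypothesis applies. Only the marginal of `Γ` has to be centred. -/
theorem FunctionalSantalo.halfSpace {n : ℕ} (ih : FunctionalSantalo n)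
    {Γ κ : ℝ × (Fin n → ℝ) → ℝ≥0∞} (hΓ : Measurable Γ) (hκ : Measurable κ)
    (hcent : ∀ z, ∫⁻ x, ∫⁻ s in Ioi 0, Γ (s, x) ≤
      ∫⁻ x, (∫⁻ s in Ioi 0, Γ (s, x)) * .ofReal (Real.exp (z ⬝ᵥ x)))
    (h : ∀ s t x y, 0 < s → 0 < t →
      Γ (s, x) * κ (t, y) ≤ .ofReal (Real.exp (-2 * (x ⬝ᵥ y + s * t)))) :
    (∫⁻ x, ∫⁻ s in Ioi 0, Γ (s, x)) * (∫⁻ y, ∫⁻ t in Ioi 0, κ (t, y)) ≤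
      .ofReal (Real.pi ^ (n + 1) / 4) := by
  have hpi := Real.pi_pos
  have hF : Measurable fun x => ∫⁻ s in Ioi 0, Γ (s, x) :=
    Measurable.lintegral_prod_left' (μ := volume.restrict (Ioi 0)) hΓ
  have hK : Measurable fun x => ∫⁻ s in Ioi 0, κ (s, x) :=
    Measurable.lintegral_prod_left' (μ := volume.restrict (Ioi 0)) hκ
  have key := ih _ (fun y => (∫⁻ t in Ioi 0, κ (t, y)) * .ofReal (4 / Real.pi)) hF
    (hK.mul_const _) hcent ?_
  · rw [lintegral_mul_const' _ _ (by simp), ← mul_assoc] at key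
    have k2 := mul_le_mul_left key (.ofReal (Real.pi / 4))
    rw [mul_assoc, ← ofReal_mul (by positivity), ← ofReal_mul (by positivity)] at k2
    convert k2 using 1
    · field_simp
      simp
    · congr 1; ring
  · intro x y
    have := lintegral_Ioi_mul_lintegral_Ioi_le (φ := fun s => Γ (s, x)) (ψ := fun t => κ (t, y))
      (by fun_prop) (by fun_prop) (c := x ⬝ᵥ y) (fun s t hs ht => h s t x y hs ht)
    rw [← mul_assoc]
    refine (mul_le_mul_left this _).trans_eq ?_
    rw [← ofReal_mul (by positivity)]
    congr 1
    field_simp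

/-- Jensen's inequality in the form `exp ℓ ≥ 1 + ℓ`. It converts a vanishing centroid into the tilt
condition used in `FunctionalSantalo`. -/
theorem measure_univ_le_lintegral_exp {α : Type*} [MeasurableSpace α] {ν : Measure α}
    [IsFiniteMeasure ν] {ℓ : α → ℝ} (hℓ : Integrable ℓ ν) (h0 : ∫ x, ℓ x ∂ν = 0) :
    ν univ ≤ ∫⁻ x, .ofReal (Real.exp (ℓ x)) ∂ν := by
  by_cases htop : ∫⁻ x, ENNReal.ofReal (Real.exp (ℓ x)) ∂ν = ∞
  · simp [htop]
  have hint : Integrable (fun x => Real.exp (ℓ x)) ν :=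
    ⟨(Real.continuous_exp.comp_aestronglyMeasurable hℓ.1), by
      rw [hasFiniteIntegral_iff_ofReal (.of_forall fun x => (Real.exp_pos _).le)]
      exact lt_top_iff_ne_top.2 htop⟩
  rw [← ofReal_integral_eq_lintegral_ofReal hint (.of_forall fun x => (Real.exp_pos _).le)]
  have h1 : ∫ x, (ℓ x + 1) ∂ν ≤ ∫ x, Real.exp (ℓ x) ∂ν :=
    integral_mono (hℓ.add (integrable_const 1)) hint fun x => Real.add_one_le_exp _
  rw [integral_add hℓ (integrable_const 1), h0, zero_add, integral_const, smul_eq_mul, mul_one] at h1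
  rw [← ofReal_measureReal]
  exact ofReal_le_ofReal h1

/-- Without atoms the distribution function is continuous; the bounded support lets it run from 0 to
the full mass on a compact interval. -/
theorem exists_measure_Iic_eq_half {μ : Measure ℝ} [IsFiniteMeasure μ] [NullSingletonClass μ] {R : ℝ}
    (hR : ∀ᵐ x ∂μ, |x| ≤ R) : ∃ a, μ.real (Iic a) = μ.real (Ioi a) := by
  have hae : ∀ᵐ x ∂μ, x ∈ Ioc (-(|R| + 1)) (|R| + 1) := by
    filter_upwards [hR] with x hx
    have := abs_le.1 (hx.trans (le_abs_self R))
    constructor <;> linarith [this.1, this.2]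
  set b := |R| + 1
  have hb : 0 < b := by positivity
  have hcont : Continuous fun a => ∫ _ in (-b)..a, (1 : ℝ) ∂μ :=
    intervalIntegral.continuous_primitive (fun _ _ => by simp) _
  have himg := intermediate_value_Icc (show -b ≤ b by linarith) hcont.continuousOn
  have hval : ∀ a, -b ≤ a → ∫ _ in (-b)..a, (1 : ℝ) ∂μ = μ.real (Iic a) := by
    intro a ha
    rw [intervalIntegral.integral_of_le ha]
    simp only [integral_const, smul_eq_mul, mul_one, measureReal_restrict_apply_univ]
    refine measureReal_congr ?_
    filter_upwards [hae] with x hx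
    exact propext ⟨fun h => h.2, fun h => ⟨hx.1, h⟩⟩
  have huniv : μ.real (Iic b) = μ.real univ := by
    refine measureReal_congr ?_
    filter_upwards [hae] with x hx
    exact propext ⟨fun h => trivial, fun h => hx.2⟩
  obtain ⟨a, ha, hav⟩ := himg (a := μ.real univ / 2) (by
    simp only [intervalIntegral.integral_same]
    rw [hval b (by linarith), huniv]
    constructor <;> linarith [measureReal_nonneg (μ := μ) (s := univ)])
  refine ⟨a, ?_⟩
  have h1 := measureReal_compl (μ := μ) (measurableSet_Iic (a := a))
  rw [compl_Iic] at h1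
  simp only at hav
  rw [hval a ha.1] at hav
  linarith

/-- A finite measure on `ℝ × ℝⁿ` with bounded support is halved by some hyperplane `s = a` in such
a way that, after a translation within the hyperplane and a shear, both halves have their
projected centroid at the origin. -/
theorem exists_halving_centring {n : ℕ} {ν : Measure (ℝ × (Fin n → ℝ))} [IsFiniteMeasure ν]
    (hν : ν ≠ 0) {R : ℝ} (hR : ∀ᵐ X ∂ν, ‖X‖ ≤ R) (hatom : ∀ a, ν {X | X.1 = a} = 0) :
    ∃ (a : ℝ) (q w : Fin n → ℝ), ν {X | a < X.1} = ν {X | X.1 < a} ∧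
      (∀ z, ν {X | a < X.1} ≤
        ∫⁻ X in {X | a < X.1}, .ofReal (Real.exp (z ⬝ᵥ (X.2 - q - (X.1 - a) • w))) ∂ν) ∧
      (∀ z, ν {X | X.1 < a} ≤
        ∫⁻ X in {X | X.1 < a}, .ofReal (Real.exp (z ⬝ᵥ (X.2 - q - (X.1 - a) • w))) ∂ν) := by
  have hNA : NullSingletonClass (ν.map Prod.fst) := ⟨fun a => by
    rw [Measure.map_apply measurable_fst (measurableSet_singleton a)]; exact hatom a⟩
  obtain ⟨a, ha⟩ := exists_measure_Iic_eq_half (μ := ν.map Prod.fst) (R := R) (by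
    refine (ae_map_iff measurable_fst.aemeasurable (by measurability)).2 ?_
    filter_upwards [hR] with X hX
    exact (norm_fst_le X).trans hX)
  rw [map_measureReal_apply measurable_fst measurableSet_Iic,
    map_measureReal_apply measurable_fst measurableSet_Ioi] at ha
  have hlt : ν.real {X | X.1 < a} = ν.real (Prod.fst ⁻¹' Iic a) := by
    refine measureReal_congr ?_
    have : ∀ᵐ X ∂ν, X.1 ≠ a := by simpa [ae_iff] using hatom a
    filter_upwards [this] with X hX
    exact propext ⟨fun h => le_of_lt h, fun h => lt_of_le_of_ne h hX⟩
  have hhalf : ν.real {X | a < X.1} = ν.real {X | X.1 < a} := by rw [hlt, ha]; rfl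
  set A : Set (ℝ × (Fin n → ℝ)) := {X | a < X.1} with hA
  set B : Set (ℝ × (Fin n → ℝ)) := {X | X.1 < a} with hB
  have hAm : MeasurableSet A := measurableSet_lt measurable_const measurable_fst
  have hBm : MeasurableSet B := measurableSet_lt measurable_fst measurable_const
  have hm : 0 < ν.real A := by
    by_contra hcon
    have h0 : ν.real A = 0 := le_antisymm (not_lt.1 hcon) measureReal_nonneg
    have h0' : ν.real B = 0 := by rw [← hhalf, h0]
    rw [measureReal_eq_zero_iff] at h0 h0'
    refine hν (Measure.measure_univ_eq_zero.1 ?_)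
    refine measure_mono_null (t := (A ∪ B) ∪ {X | X.1 = a}) ?_ ?_
    · intro X _
      rcases lt_trichotomy X.1 a with h | h | h
      · exact .inl (.inr h)
      · exact .inr h
      · exact .inl (.inl h)
    · simp [h0, h0', hatom]
  have hint1 : Integrable (fun X => X.1) ν := Integrable.of_bound (C := R)
    measurable_fst.aestronglyMeasurable (by
      filter_upwards [hR] with X hX using (norm_fst_le X).trans hX)
  have hint2 : ∀ i, Integrable (fun X => X.2 i) ν := fun i => Integrable.of_bound (C := R)
    (by fun_prop) (by
      filter_upwards [hR] with X hX using (norm_le_pi_norm X.2 i).trans ((norm_snd_le X).trans hX))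
  set p := ∫ X in A, (X.1 - a) ∂ν with hp
  set p' := ∫ X in B, (X.1 - a) ∂ν with hp'
  have hppos : 0 < p := by
    rw [hp, setIntegral_pos_iff_support_of_nonneg_ae]
    · have : (Function.support fun X : ℝ × (Fin n → ℝ) => X.1 - a) ∩ A = A := by
        refine inter_eq_right.2 fun X (hX : a < X.1) => ?_
        simpa [sub_eq_zero] using hX.ne'
      rw [this]
      exact (ENNReal.toReal_pos_iff.1 hm).1
    · filter_upwards [ae_restrict_mem hAm] with X hX
      exact (sub_pos.2 hX).le
    · exact (hint1.sub (integrable_const a)).integrableOn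
  have hpneg : p' ≤ 0 := setIntegral_nonpos hBm fun X hX => (sub_neg.2 hX).le
  -- The line `s ↦ (s, q + (s - a) • w)` is to pass through the centroids of both halves. As the
  -- halves have equal mass, subtracting the two centroid equations eliminates `q` and determines
  -- `w`; the divisor `p - p'` is positive.
  set w : Fin n → ℝ := fun i => ((∫ X in A, X.2 i ∂ν) - ∫ X in B, X.2 i ∂ν) / (p - p') with hw
  set q : Fin n → ℝ := fun i => ((∫ X in A, X.2 i ∂ν) - p * w i) / ν.real A with hq
  have hwp : ∀ i, w i * (p - p') = (∫ X in A, X.2 i ∂ν) - ∫ X in B, X.2 i ∂ν := fun i =>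
    div_mul_cancel₀ _ (by linarith)
  have hqp : ∀ i, q i * ν.real A = (∫ X in A, X.2 i ∂ν) - p * w i := fun i =>
    div_mul_cancel₀ _ hm.ne'
  have hcoord : ∀ (S : Set (ℝ × (Fin n → ℝ))) i, ∫ X in S, (X.2 i - q i - (X.1 - a) * w i) ∂ν
      = (∫ X in S, X.2 i ∂ν) - ν.real S * q i - (∫ X in S, (X.1 - a) ∂ν) * w i := by
    intro S i
    have i1 : Integrable (fun X => X.2 i) (ν.restrict S) := (hint2 i).integrableOn
    have i2 : Integrable (fun X => X.1 - a) (ν.restrict S) :=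
      (hint1.sub (integrable_const a)).integrableOn
    have i3 : Integrable (fun X => X.2 i - q i) (ν.restrict S) := i1.sub (integrable_const _)
    rw [integral_sub i3 (i2.mul_const _), integral_sub i1 (integrable_const _), integral_mul_const]
    simp
  have hzA : ∀ i, ∫ X in A, (X.2 i - q i - (X.1 - a) * w i) ∂ν = 0 := fun i => by
    rw [hcoord]; linarith [hqp i]
  have hzB : ∀ i, ∫ X in B, (X.2 i - q i - (X.1 - a) * w i) ∂ν = 0 := fun i => by
    rw [hcoord, ← hhalf]; linarith [hqp i, hwp i]
  have hJ : ∀ (S : Set (ℝ × (Fin n → ℝ))),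
      (∀ i, ∫ X in S, (X.2 i - q i - (X.1 - a) * w i) ∂ν = 0) → ∀ z, ν S ≤
      ∫⁻ X in S, .ofReal (Real.exp (z ⬝ᵥ (X.2 - q - (X.1 - a) • w))) ∂ν := by
    intro S hS z
    have hi : ∀ i, Integrable (fun X => z i * (X.2 i - q i - (X.1 - a) * w i)) (ν.restrict S) :=
      fun i => ((((hint2 i).sub (integrable_const _)).sub
        ((hint1.sub (integrable_const a)).mul_const _)).integrableOn).const_mul _
    rw [← Measure.restrict_apply_univ]
    refine measure_univ_le_lintegral_exp (integrable_finsetSum _ fun i _ => hi i) ?_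
    simp only [dotProduct, Pi.sub_apply, Pi.smul_apply, smul_eq_mul]
    rw [integral_finsetSum _ fun i _ => hi i]
    exact Finset.sum_eq_zero fun i _ => by rw [integral_const_mul, hS i, mul_zero]
  refine ⟨a, q, w, ?_, hJ A hzA, hJ B hzB⟩
  rwa [measureReal_eq_measureReal_iff] at hhalf

/-- On each slice of constant `s` the map is a translation, so the shear preserves volume. -/
theorem lintegral_shear {n : ℕ} {G : ℝ × (Fin n → ℝ) → ℝ≥0∞} (hG : Measurable G) (a : ℝ)
    (q w : Fin n → ℝ) : ∫⁻ x, ∫⁻ s, G (a + s, q + x + s • w) = ∫⁻ X, G X := by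
  rw [lintegral_lintegral_swap (by fun_prop)]
  have : ∀ s, ∫⁻ x, G (a + s, q + x + s • w) = ∫⁻ x, G (a + s, x) := fun s => by
    have := lintegral_add_left_eq_self (μ := volume) (fun x => G (a + s, x)) (q + s • w)
    rw [← this]
    congr with x
    congr 2
    abel
  simp_rw [this]
  rw [lintegral_add_left_eq_self (μ := volume) (fun s => ∫⁻ x, G (s, x)) a, Measure.volume_eq_prod,
    lintegral_prod _ hG.aemeasurable]

theorem setLIntegral_shear {n : ℕ} {g : ℝ × (Fin n → ℝ) → ℝ≥0∞} (hg : Measurable g)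
    {W : (Fin n → ℝ) → ℝ≥0∞} (hW : Measurable W) {S : Set ℝ} (hS : MeasurableSet S) (a : ℝ)
    (q w : Fin n → ℝ) :
    ∫⁻ x, (∫⁻ s in S, g (a + s, q + x + s • w)) * W x =
      ∫⁻ X in {X | X.1 - a ∈ S}, g X * W (X.2 - q - (X.1 - a) • w) := by
  have hm : MeasurableSet {X : ℝ × (Fin n → ℝ) | X.1 - a ∈ S} :=
    hS.preimage (measurable_fst.sub_const a)
  rw [← lintegral_indicator hm, ← lintegral_shear _ a q w]
  · congr with x
    rw [← lintegral_mul_const _ (by fun_prop), ← lintegral_indicator hS]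
    congr with s
    have e : q + x + s • w - q - (a + s - a) • w = x := by
      rw [add_sub_cancel_left]; abel
    by_cases hs : s ∈ S
    · rw [indicator_of_mem hs, indicator_of_mem (by simpa using hs)]
      simp only [e]
    · rw [indicator_of_notMem hs, indicator_of_notMem (by simpa using hs)]
  · exact Measurable.indicator (by fun_prop) hm

theorem setLIntegral_Ioi_comp_neg (f : ℝ → ℝ≥0∞) :
    ∫⁻ s in Ioi 0, f (-s) = ∫⁻ s in Iio 0, f s := by
  rw [← lintegral_indicator measurableSet_Ioi, ← lintegral_indicator measurableSet_Iio,
    ← lintegral_neg_eq_self]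
  congr with s
  simp [indicator]

/-- The centre `(a, q)` depends on `g` alone and serves every `k`; this order of quantifiers lets
`prod` choose `k` in terms of the centre. Each half of `g` is paired with the corresponding half of
`k` after the shear. -/
theorem FunctionalSantalo.exists_centre {n : ℕ} (ih : FunctionalSantalo n)
    {g : ℝ × (Fin n → ℝ) → ℝ≥0∞} (hg : Measurable g) (hfin : ∫⁻ X, g X ≠ ∞) {R : ℝ}
    (hR : ∀ X, R < ‖X‖ → g X = 0) :
    ∃ (a : ℝ) (q : Fin n → ℝ), ∀ k : ℝ × (Fin n → ℝ) → ℝ≥0∞, Measurable k →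
      (∀ X Y : ℝ × (Fin n → ℝ), g (a + X.1, q + X.2) * k Y ≤
        .ofReal (Real.exp (-2 * (X.2 ⬝ᵥ Y.2 + X.1 * Y.1)))) →
      (∫⁻ X, g X) * ∫⁻ Y, k Y ≤ .ofReal (Real.pi ^ (n + 1)) := by
  rcases eq_or_ne (∫⁻ X, g X) 0 with h0 | h0
  · exact ⟨0, 0, fun k _ _ => by simp [h0]⟩
  set ν := (volume : Measure (ℝ × (Fin n → ℝ))).withDensity g with hν
  have : IsFiniteMeasure ν := isFiniteMeasure_withDensity hfin
  obtain ⟨a, q, w, hhalf, hpos, hneg⟩ := exists_halving_centring (ν := ν) (R := R)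
    (by
      rw [← Measure.measure_univ_ne_zero, hν, withDensity_apply _ .univ]
      simpa using h0)
    (by
      rw [hν, ae_withDensity_iff hg]
      refine .of_forall fun X hX => ?_
      by_contra hcon
      exact hX (hR X (not_le.1 hcon)))
    (fun a => by
      refine withDensity_absolutelyContinuous _ _ ?_
      have : {X : ℝ × (Fin n → ℝ) | X.1 = a} = {a} ×ˢ univ := by ext; simp
      rw [this, Measure.volume_eq_prod, Measure.prod_prod]
      simp)
  refine ⟨a, q, fun k hk hgk => ?_⟩
  set Γ : ℝ × (Fin n → ℝ) → ℝ≥0∞ := fun X => g (a + X.1, q + X.2 + X.1 • w) with hΓ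
  -- The inverse transpose of the shear applied to `g`: it keeps the pairing `x ⬝ᵥ y + s * t` and
  -- the volume.
  set κ : ℝ × (Fin n → ℝ) → ℝ≥0∞ := fun Y => k (Y.1 - w ⬝ᵥ Y.2, Y.2) with hκ
  have hdot : Measurable fun y : Fin n → ℝ => w ⬝ᵥ y := by
    unfold dotProduct; fun_prop
  have hΓm : Measurable Γ := by fun_prop
  have hκm : Measurable κ := hk.comp ((measurable_fst.sub (hdot.comp measurable_snd)).prodMk
    measurable_snd)
  have hbound : ∀ s t x y, Γ (s, x) * κ (t, y) ≤
      .ofReal (Real.exp (-2 * (x ⬝ᵥ y + s * t))) := by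
    intro s t x y
    have := hgk (s, x + s • w) (t - w ⬝ᵥ y, y)
    simp only [← add_assoc, add_dotProduct, smul_dotProduct, smul_eq_mul] at this
    refine this.trans_eq ?_
    congr 3
    ring
  have hexp : ∀ z : Fin n → ℝ,
      Measurable fun x : Fin n → ℝ => ENNReal.ofReal (Real.exp (z ⬝ᵥ x)) := by
    intro z; unfold dotProduct; fun_prop
  have hmass : ∀ S : Set ℝ, MeasurableSet S →
      ∫⁻ x, ∫⁻ s in S, Γ (s, x) = ν {X | X.1 - a ∈ S} := by
    intro S hS
    have := setLIntegral_shear hg (W := fun _ => 1) measurable_const hS a q w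
    simp only [mul_one] at this
    have hm : MeasurableSet {X : ℝ × (Fin n → ℝ) | X.1 - a ∈ S} :=
      hS.preimage (measurable_fst.sub_const a)
    rw [hν, withDensity_apply _ hm, ← this]
  have htilt : ∀ S : Set ℝ, MeasurableSet S → ∀ z : Fin n → ℝ,
      ∫⁻ x, (∫⁻ s in S, Γ (s, x)) * .ofReal (Real.exp (z ⬝ᵥ x)) =
      ∫⁻ X in {X | X.1 - a ∈ S},
        .ofReal (Real.exp (z ⬝ᵥ (X.2 - q - (X.1 - a) • w))) ∂ν := by
    intro S hS z
    have hm : MeasurableSet {X : ℝ × (Fin n → ℝ) | X.1 - a ∈ S} :=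
      hS.preimage (measurable_fst.sub_const a)
    have hmap : Measurable fun X : ℝ × (Fin n → ℝ) => X.2 - q - (X.1 - a) • w := by fun_prop
    exact (setLIntegral_shear hg (hexp z) hS a q w).trans
      (setLIntegral_withDensity_eq_setLIntegral_mul _ hg ((hexp z).comp hmap) hm).symm
  have hset1 : {X : ℝ × (Fin n → ℝ) | X.1 - a ∈ Ioi 0} = {X | a < X.1} := by ext; simp
  have hset2 : {X : ℝ × (Fin n → ℝ) | X.1 - a ∈ Iio 0} = {X | X.1 < a} := by ext; simp
  have key1 := ih.halfSpace hΓm hκm (fun z => by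
    rw [hmass _ measurableSet_Ioi, htilt _ measurableSet_Ioi, hset1]; exact hpos z)
    (fun s t x y _ _ => hbound s t x y)
  have key2 := ih.halfSpace (Γ := fun X => Γ (-X.1, X.2)) (κ := fun X => κ (-X.1, X.2))
    (by fun_prop) (by fun_prop) (fun z => by
      have e : ∀ x, ∫⁻ s in Ioi 0, Γ (-s, x) = ∫⁻ s in Iio 0, Γ (s, x) := fun x =>
        setLIntegral_Ioi_comp_neg fun s => Γ (s, x)
      simp only [e]
      rw [hmass _ measurableSet_Iio, htilt _ measurableSet_Iio, hset2]; exact hneg z)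
    (fun s t x y _ _ => by simpa using hbound (-s) (-t) x y)
  have e1 : ∀ x, ∫⁻ s in Ioi 0, Γ (-s, x) = ∫⁻ s in Iio 0, Γ (s, x) := fun x =>
    setLIntegral_Ioi_comp_neg fun s => Γ (s, x)
  have e2 : ∀ x, ∫⁻ s in Ioi 0, κ (-s, x) = ∫⁻ s in Iio 0, κ (s, x) := fun x =>
    setLIntegral_Ioi_comp_neg fun s => κ (s, x)
  simp only [e1, e2] at key2
  have hsplit : ∀ f : ℝ → ℝ≥0∞, ∫⁻ s, f s = (∫⁻ s in Ioi 0, f s) + ∫⁻ s in Iio 0, f s := by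
    intro f
    rw [← lintegral_add_compl f measurableSet_Ioi, compl_Ioi,
      setLIntegral_congr (Iio_ae_eq_Iic (a := (0 : ℝ)))]
  have hIoi : ∀ {f : ℝ × (Fin n → ℝ) → ℝ≥0∞}, Measurable f → ∀ S : Set ℝ,
      Measurable fun x => ∫⁻ s in S, f (s, x) := fun hf S =>
    Measurable.lintegral_prod_left' (μ := volume.restrict S) hf
  have hk_eq : ∫⁻ Y, k Y = (∫⁻ y, ∫⁻ t in Ioi 0, κ (t, y)) + ∫⁻ y, ∫⁻ t in Iio 0, κ (t, y) := by
    rw [← lintegral_add_left (hIoi hκm _), Measure.volume_eq_prod, lintegral_prod_symm _ hk.aemeasurable]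
    congr with y
    rw [← hsplit]
    exact (lintegral_sub_right_eq_self (fun t => k (t, y)) (w ⬝ᵥ y)).symm
  have hg_eq : ∫⁻ X, g X = (∫⁻ y, ∫⁻ t in Ioi 0, Γ (t, y)) + ∫⁻ y, ∫⁻ t in Iio 0, Γ (t, y) := by
    rw [← lintegral_add_left (hIoi hΓm _), ← lintegral_shear hg a q w]
    congr with y
    rw [← hsplit]
  have heq : ∫⁻ y, ∫⁻ t in Iio 0, Γ (t, y) = ∫⁻ y, ∫⁻ t in Ioi 0, Γ (t, y) := by
    rw [hmass _ measurableSet_Ioi, hmass _ measurableSet_Iio, hset1, hset2, hhalf]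
  rw [hg_eq, hk_eq, heq]
  rw [heq] at key2
  -- Both halves of `g` have the same mass, so the product is twice that mass times the sum over the
  -- two halves of `k`; each of the two terms contributes at most a quarter of `π ^ (n + 1)`.
  calc _ = 2 * ((∫⁻ y, ∫⁻ t in Ioi 0, Γ (t, y)) * (∫⁻ y, ∫⁻ t in Ioi 0, κ (t, y)) +
          (∫⁻ y, ∫⁻ t in Ioi 0, Γ (t, y)) * ∫⁻ y, ∫⁻ t in Iio 0, κ (t, y)) := by ring
    _ ≤ 2 * (.ofReal (Real.pi ^ (n + 1) / 4) + .ofReal (Real.pi ^ (n + 1) / 4)) := by gcongr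
    _ = _ := by
      have := Real.pi_pos
      rw [← ofReal_add (by positivity) (by positivity), ← ofReal_ofNat 2,
        ← ofReal_mul (by positivity)]
      congr 1
      ring

/-- Translating `g` to its centre costs an exponential factor in the pointwise bound. That factor is
absorbed into `f` as a tilt, and the centring of `f` says that tilting does not lower its mass. -/
theorem FunctionalSantalo.prod {n : ℕ} (ih : FunctionalSantalo n)
    {f g : ℝ × (Fin n → ℝ) → ℝ≥0∞} (hf : Measurable f) (hg : Measurable g)
    (hcent : ∀ Z : ℝ × (Fin n → ℝ),
      ∫⁻ X, f X ≤ ∫⁻ X, f X * .ofReal (Real.exp (Z.1 * X.1 + Z.2 ⬝ᵥ X.2)))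
    (h : ∀ X Y, f X * g Y ≤ .ofReal (Real.exp (-2 * (X.1 * Y.1 + X.2 ⬝ᵥ Y.2)))) :
    (∫⁻ X, f X) * ∫⁻ Y, g Y ≤ .ofReal (Real.pi ^ (n + 1)) := by
  -- Truncating both height and support gives the finite mass and bounded support needed for a
  -- centre; monotone convergence removes the truncation.
  set G : ℕ → ℝ × (Fin n → ℝ) → ℝ≥0∞ := fun N =>
    (Metric.closedBall 0 N).indicator fun X => min (g X) N with hG
  have hGm : ∀ N, Measurable (G N) := fun N =>
    (hg.min measurable_const).indicator Metric.isClosed_closedBall.measurableSet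
  have hGle : ∀ N X, G N X ≤ g X := fun N X =>
    (indicator_le_self' (fun _ _ => zero_le) X).trans (min_le_left _ _)
  have hGmono : Monotone G := by
    intro M N hMN X
    have hMN' : (M : ℝ) ≤ N := by exact_mod_cast hMN
    refine (indicator_le_indicator_of_subset (Metric.closedBall_subset_closedBall hMN')
      (fun _ => zero_le) X).trans (indicator_le_indicator ?_)
    exact min_le_min_left _ (by exact_mod_cast hMN)
  have hsup : ∀ X, ⨆ N, G N X = g X := by
    intro X
    refine le_antisymm (iSup_le fun N => hGle N X) ?_
    have : g X = ⨆ N : ℕ, min (g X) N := by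
      rw [← inf_iSup_eq, ENNReal.iSup_natCast, inf_top_eq]
    rw [this]
    refine iSup_le fun N => ?_
    obtain ⟨M, hM⟩ := exists_nat_ge ‖X‖
    refine le_trans ?_ (le_iSup _ (max M N))
    have : X ∈ Metric.closedBall (0 : ℝ × (Fin n → ℝ)) ((max M N : ℕ) : ℝ) := by
      rw [mem_closedBall_zero_iff]
      exact hM.trans (by exact_mod_cast le_max_left _ _)
    simp only [hG]
    rw [indicator_of_mem this]
    exact min_le_min_left _ (by exact_mod_cast le_max_right _ _)
  have : ∫⁻ Y, g Y = ⨆ N, ∫⁻ Y, G N Y := by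
    rw [← lintegral_iSup hGm hGmono]
    simp_rw [hsup]
  rw [this, ENNReal.mul_iSup]
  refine iSup_le fun N => ?_
  have hfin : ∫⁻ X, G N X ≠ ∞ := by
    rw [hG, lintegral_indicator Metric.isClosed_closedBall.measurableSet]
    refine ne_top_of_le_ne_top ?_ (lintegral_mono (g := fun _ => (N : ℝ≥0∞)) fun X => min_le_right _ _)
    rw [lintegral_const, Measure.restrict_apply_univ]
    exact ENNReal.mul_ne_top (by simp) measure_closedBall_lt_top.ne
  obtain ⟨a, q, hk⟩ := ih.exists_centre (hGm N) hfin (R := N) (fun X hX => by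
    simp only [hG]
    exact indicator_of_notMem (by simpa using hX) _)
  have hdot : Measurable fun y : Fin n → ℝ => q ⬝ᵥ y := by
    unfold dotProduct; fun_prop
  have hdot' : Measurable fun Y : ℝ × (Fin n → ℝ) => q ⬝ᵥ Y.2 := hdot.comp measurable_snd
  have key := hk (fun Y => f Y * .ofReal (Real.exp (2 * a * Y.1 + (2 • q) ⬝ᵥ Y.2)))
    (by simp only [smul_dotProduct]; fun_prop) ?_
  · rw [mul_comm]
    refine le_trans ?_ key
    exact mul_le_mul' le_rfl (hcent (2 * a, 2 • q))
  · intro X Y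
    calc _ ≤ g (a + X.1, q + X.2) * (f Y * .ofReal (Real.exp (2 * a * Y.1 + (2 • q) ⬝ᵥ Y.2))) := by
          gcongr; exact hGle _ _
      _ = (f Y * g (a + X.1, q + X.2)) * .ofReal (Real.exp (2 * a * Y.1 + (2 • q) ⬝ᵥ Y.2)) := by
          ring
      _ ≤ .ofReal (Real.exp (-2 * (Y.1 * (a + X.1) + Y.2 ⬝ᵥ (q + X.2)))) *
            .ofReal (Real.exp (2 * a * Y.1 + (2 • q) ⬝ᵥ Y.2)) := by
          gcongr; exact h _ _
      _ = _ := by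
          rw [← ofReal_mul (by positivity), ← Real.exp_add]
          congr 2
          rw [dotProduct_add, smul_dotProduct, dotProduct_comm Y.2, dotProduct_comm Y.2, nsmul_eq_mul]
          push_cast
          ring

/-- The functional Santaló inequality (Ball, Artstein-Avidan–Klartag–Milman; the inductive proof
is Lehec's). -/
theorem functionalSantalo (n : ℕ) : FunctionalSantalo n := by
  induction n with
  | zero =>
    intro f g _ _ _ h
    have : (volume : Measure (Fin 0 → ℝ)) = Measure.dirac 0 := by
      rw [volume_pi]
      exact Measure.pi_of_empty _ _
    simp only [this, lintegral_dirac]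
    simpa using h 0 0
  | succ n ih =>
    intro f g hf hg hcent h
    set e := (MeasurableEquiv.piFinSuccAbove (fun _ : Fin (n + 1) => ℝ) 0).symm
    have he : MeasurePreserving e := (volume_preserving_piFinSuccAbove (fun _ => ℝ) 0).symm _
    have hdot : ∀ X Y : ℝ × (Fin n → ℝ), e X ⬝ᵥ e Y = X.1 * Y.1 + X.2 ⬝ᵥ Y.2 := by
      intro X Y
      simp [dotProduct, Fin.sum_univ_succ, e, MeasurableEquiv.piFinSuccAbove]
    rw [← he.lintegral_comp_emb e.measurableEmbedding, ← he.lintegral_comp_emb e.measurableEmbedding]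
    refine ih.prod (hf.comp e.measurable) (hg.comp e.measurable) (fun Z => ?_) fun X Y => ?_
    · have := hcent (e Z)
      rw [← he.lintegral_comp_emb e.measurableEmbedding,
        ← he.lintegral_comp_emb e.measurableEmbedding] at this
      simpa only [hdot] using this
    · simpa only [hdot] using h (e X) (e Y)

/-- The functional Santaló inequality for an even function `f` on Euclidean space. -/
theorem lintegral_mul_lintegral_le_of_even {n : ℕ} {f g : EuclideanSpace ℝ (Fin n) → ℝ≥0∞}
    (hf : Measurable f) (hg : Measurable g) (heven : ∀ x, f (-x) = f x)
    (h : ∀ x y, f x * g y ≤ .ofReal (Real.exp (-2 * inner ℝ x y))) :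
    (∫⁻ x, f x) * ∫⁻ y, g y ≤ .ofReal (Real.pi ^ n) := by
  have hm : MeasurableEmbedding (WithLp.toLp 2 : (Fin n → ℝ) → EuclideanSpace ℝ (Fin n)) :=
    (MeasurableEquiv.toLp 2 (Fin n → ℝ)).measurableEmbedding
  have hT := PiLp.volume_preserving_toLp (Fin n)
  rw [← hT.lintegral_comp_emb hm, ← hT.lintegral_comp_emb hm]
  refine functionalSantalo n _ _ (hf.comp hm.measurable) (hg.comp hm.measurable) (fun z => ?_)
    fun x y => ?_
  · have hmz : ∀ z : Fin n → ℝ, Measurable fun x : Fin n → ℝ =>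
        f (WithLp.toLp 2 x) * .ofReal (Real.exp (z ⬝ᵥ x)) := by
      intro z
      unfold dotProduct
      exact (hf.comp hm.measurable).mul (by fun_prop)
    have e : ∫⁻ x : Fin n → ℝ, f (WithLp.toLp 2 x) * .ofReal (Real.exp (z ⬝ᵥ x)) =
        ∫⁻ x : Fin n → ℝ, f (WithLp.toLp 2 x) * .ofReal (Real.exp (-z ⬝ᵥ x)) := by
      rw [← lintegral_neg_eq_self]
      congr with x
      rw [WithLp.toLp_neg, heven, dotProduct_neg, neg_dotProduct]
    -- For even `f`, the tilts by `z` and `-z` have equal mass, and `exp s + exp (-s) ≥ 2`.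
    have h2 : 2 * ∫⁻ x : Fin n → ℝ, f (WithLp.toLp 2 x) ≤
        2 * ∫⁻ x : Fin n → ℝ, f (WithLp.toLp 2 x) * .ofReal (Real.exp (z ⬝ᵥ x)) := by
      conv_rhs => rw [two_mul]; arg 2; rw [e]
      rw [← lintegral_add_left (hmz z), ← lintegral_const_mul' _ _ (by simp)]
      refine lintegral_mono fun x => ?_
      rw [← mul_add, mul_comm, ← ofReal_add (by positivity) (by positivity)]
      gcongr
      rw [← ofReal_ofNat 2]
      gcongr
      rw [neg_dotProduct]
      linarith [Real.add_one_le_exp (z ⬝ᵥ x), Real.add_one_le_exp (-(z ⬝ᵥ x))]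
    exact (ENNReal.mul_le_mul_iff_right (by simp) (by simp)).1 h2
  · have := h (WithLp.toLp 2 x) (WithLp.toLp 2 y)
    simp only [EuclideanSpace.inner_toLp_toLp, star_trivial] at this
    rwa [dotProduct_comm]

/-! ### From functions to bodies: the Blaschke–Santaló inequality and polar coordinates. -/

/-- Layer-cake evaluation of the Gaussian integral of a norm. Stating only `≤` avoids proving
integrability, as `toReal` sends `∞` to 0. -/
theorem measure_lt_one_le_lintegral_div_Gamma {n : ℕ} {p : EuclideanSpace ℝ (Fin n) → ℝ}
    (hp : Measurable p)
    (h1 : p 0 = 0) (h2 : ∀ x, p (-x) = p x) (h3 : ∀ x y, p (x + y) ≤ p x + p y)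
    (h4 : ∀ {x}, p x = 0 → x = 0) (h5 : ∀ r x, p (r • x) ≤ |r| * p x) :
    volume {x | p x < 1} * .ofReal (Real.Gamma (n / 2 + 1)) ≤
      ∫⁻ x, .ofReal (Real.exp (-p x ^ 2)) := by
  have hG : 0 < Real.Gamma (n / 2 + 1) := Real.Gamma_pos_of_pos (by positivity)
  rw [measure_lt_one_eq_integral_div_gamma volume h1 h2 h3 h4 h5 (p := 2) two_pos,
    ofReal_div_of_pos (by simpa using hG)]
  simp only [finrank_euclideanSpace, Fintype.card_fin, Real.rpow_ofNat]
  rw [ENNReal.div_mul_cancel (by simpa using hG) (by simp),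
    integral_eq_lintegral_of_nonneg_ae (.of_forall fun x => by positivity)
      (by fun_prop)]
  exact ofReal_toReal_le

/-- Blaschke–Santaló inequality, for the unit balls of two norms `p`, `q` with
`⟪x, y⟫ ≤ p x * q y`. -/
theorem volume_mul_volume_le {n : ℕ} (hn : 1 ≤ n) {p q : EuclideanSpace ℝ (Fin n) → ℝ}
    (hp : Measurable p) (hq : Measurable q)
    (p1 : p 0 = 0) (p2 : ∀ x, p (-x) = p x) (p3 : ∀ x y, p (x + y) ≤ p x + p y)
    (p4 : ∀ {x}, p x = 0 → x = 0) (p5 : ∀ r x, p (r • x) ≤ |r| * p x)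
    (q1 : q 0 = 0) (q2 : ∀ x, q (-x) = q x) (q3 : ∀ x y, q (x + y) ≤ q x + q y)
    (q4 : ∀ {x}, q x = 0 → x = 0) (q5 : ∀ r x, q (r • x) ≤ |r| * q x)
    (hpq : ∀ x y, inner ℝ x y ≤ p x * q y) :
    volume {x | p x < 1} * volume {x | q x < 1} ≤
      volume (Metric.ball (0 : EuclideanSpace ℝ (Fin n)) 1) ^ 2 := by
  have : Nonempty (Fin n) := ⟨⟨0, hn⟩⟩
  have hG : 0 < Real.Gamma (n / 2 + 1) := Real.Gamma_pos_of_pos (by positivity)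
  have hP := measure_lt_one_le_lintegral_div_Gamma hp p1 p2 p3 p4 p5
  have hQ := measure_lt_one_le_lintegral_div_Gamma hq q1 q2 q3 q4 q5
  -- The pointwise condition is `2 ⟪x, y⟫ ≤ 2 p x * q y ≤ p x ^ 2 + q y ^ 2`. For the Euclidean norm
  -- the Gaussian integrals give equality, which identifies the constant in `hball`.
  have key := lintegral_mul_lintegral_le_of_even
    (f := fun x => .ofReal (Real.exp (-p x ^ 2))) (g := fun x => .ofReal (Real.exp (-q x ^ 2)))
    (by fun_prop) (by fun_prop) (fun x => by rw [p2]) (fun x y => by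
      rw [← ofReal_mul (by positivity), ← Real.exp_add]
      gcongr
      nlinarith [hpq x y, sq_nonneg (p x - q y)])
  have k2 := (mul_le_mul' hP hQ).trans key
  set G := ENNReal.ofReal (Real.Gamma (n / 2 + 1)) with hGdef
  have hball : volume (Metric.ball (0 : EuclideanSpace ℝ (Fin n)) 1) ^ 2 * G ^ 2 =
      .ofReal (Real.pi ^ n) := by
    rw [EuclideanSpace.volume_ball, Fintype.card_fin, ofReal_one, one_pow, one_mul, hGdef,
      ← mul_pow, ← ofReal_mul (by positivity), ← ofReal_pow (by positivity),
      div_mul_cancel₀ _ hG.ne', ← pow_mul, mul_comm n, pow_mul, Real.sq_sqrt Real.pi_pos.le]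
  refine (ENNReal.mul_le_mul_iff_left (c := G ^ 2) ?_ (by simp [hGdef])).1 ?_
  · simpa [hGdef] using hG
  · rw [hball]
    refine le_trans (le_of_eq ?_) k2
    ring

/-- Volume in polar coordinates of the unit ball of a positively homogeneous function. -/
theorem volume_lt_one_eq_lintegral_sphere {n : ℕ} (hn : 1 ≤ n) {p : EuclideanSpace ℝ (Fin n) → ℝ}
    (hp : Measurable p) (hpos : ∀ x ≠ 0, 0 < p x) (hhom : ∀ r x, 0 ≤ r → p (r • x) = r * p x) :
    volume {x | p x < 1} = ∫⁻ u, .ofReal ((p u)⁻¹ ^ n / n) ∂sphereMeasure n := by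
  have : Nonempty (Fin n) := ⟨⟨0, hn⟩⟩
  have hmp := (volume : Measure (EuclideanSpace ℝ (Fin n))).measurePreserving_homeomorphUnitSphereProd
  rw [finrank_euclideanSpace, Fintype.card_fin] at hmp
  set S : Set (Metric.sphere (0 : EuclideanSpace ℝ (Fin n)) 1 × Ioi (0 : ℝ)) :=
    {X | (X.2 : ℝ) * p X.1 < 1} with hS
  have hSm : MeasurableSet S := measurableSet_lt (by fun_prop) measurable_const
  have h1 := hmp.measure_preimage hSm.nullMeasurableSet
  rw [comap_subtype_coe_apply (measurableSet_singleton _).compl, Measure.prod_apply hSm] at h1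
  have h2 : Subtype.val '' (homeomorphUnitSphereProd (EuclideanSpace ℝ (Fin n)) ⁻¹' S) =
      {x | p x < 1} \ {0} := by
    ext x
    simp only [mem_image, Subtype.exists, mem_preimage, exists_and_right, exists_eq_right, hS,
      mem_ofPred_eq, homeomorphUnitSphereProd_apply_snd_coe, homeomorphUnitSphereProd_apply_fst_coe,
      ← hhom _ _ (norm_nonneg _), Set.mem_sdiff, mem_singleton_iff, mem_compl_iff]
    constructor
    · rintro ⟨hx, h⟩
      rw [smul_inv_smul₀ (norm_ne_zero_iff.2 hx)] at h
      exact ⟨h, hx⟩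
    · rintro ⟨h, hx⟩
      refine ⟨hx, ?_⟩
      rwa [smul_inv_smul₀ (norm_ne_zero_iff.2 hx)]
  rw [h2, measure_sdiff_null (measure_singleton _)] at h1
  rw [h1]
  refine lintegral_congr fun u => ?_
  have hu : 0 < p u := hpos _ (by
    intro h0
    have := u.2
    rw [mem_sphere_zero_iff_norm, h0] at this
    simp at this)
  have h3 : Prod.mk u ⁻¹' S = Iio ⟨(p u)⁻¹, inv_pos.2 hu⟩ := by
    ext r
    simp only [hS, mem_preimage, mem_ofPred_eq, mem_Iio, ← Subtype.coe_lt_coe]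
    rw [← lt_div_iff₀ hu, one_div]
  rw [h3, Measure.volumeIoiPow_apply_Iio]
  congr 1
  have : ((n - 1 : ℕ) : ℝ) + 1 = n := by
    rw [Nat.cast_sub hn]; simp
  rw [this, Nat.sub_add_cancel hn]

/-! ### Support functions, gauges and the polar body. -/

section SupportFunction

variable {n : ℕ} {L : Set (EuclideanSpace ℝ (Fin n))}

theorem inner_le_supportFun (hL : IsCompact L) {x : EuclideanSpace ℝ (Fin n)} (hx : x ∈ L)
    (u : EuclideanSpace ℝ (Fin n)) : inner ℝ x u ≤ supportFun L u :=
  le_csSup (hL.image (by fun_prop)).bddAbove (mem_image_of_mem _ hx)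

theorem supportFun_le (hL : L.Nonempty) {u : EuclideanSpace ℝ (Fin n)} {c : ℝ}
    (h : ∀ x ∈ L, inner ℝ x u ≤ c) : supportFun L u ≤ c :=
  csSup_le (hL.image _) (by rintro _ ⟨x, hx, rfl⟩; exact h x hx)

theorem supportFun_zero (hL : L.Nonempty) : supportFun L 0 = 0 := by
  simp [supportFun, hL]

theorem supportFun_add_le (hL : IsCompact L) (hL' : L.Nonempty)
    (u v : EuclideanSpace ℝ (Fin n)) :
    supportFun L (u + v) ≤ supportFun L u + supportFun L v :=
  supportFun_le hL' fun x hx => by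
    rw [inner_add_right]
    exact add_le_add (inner_le_supportFun hL hx u) (inner_le_supportFun hL hx v)

theorem supportFun_neg (hsymm : -L = L) (u : EuclideanSpace ℝ (Fin n)) :
    supportFun L (-u) = supportFun L u := by
  unfold supportFun
  conv_lhs => rw [← hsymm, ← Set.image_neg_eq_neg, image_image]
  simp

theorem supportFun_smul {r : ℝ} (hr : 0 ≤ r) (u : EuclideanSpace ℝ (Fin n)) :
    supportFun L (r • u) = r * supportFun L u := by
  unfold supportFun
  rw [← smul_eq_mul, ← Real.sSup_smul_of_nonneg hr, ← image_smul, image_image]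
  simp [inner_smul_right]

theorem continuous_supportFun (hL : IsCompact L) (hL' : L.Nonempty) :
    Continuous (supportFun L) := by
  obtain ⟨C, hC⟩ := hL.isBounded.exists_norm_le
  refine (LipschitzWith.of_le_add_mul C.toNNReal fun u v => ?_).continuous
  refine supportFun_le hL' fun x hx => ?_
  have h1 : inner ℝ x u = inner ℝ x v + inner ℝ x (u - v) := by
    rw [← inner_add_right, add_sub_cancel]
  rw [h1]
  gcongr
  · exact inner_le_supportFun hL hx v
  · rw [dist_eq_norm]
    refine (real_inner_le_norm _ _).trans ?_
    gcongr
    exact (hC x hx).trans (Real.le_coe_toNNReal C)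

theorem supportFun_pos (hL : IsCompact L) (h0 : (0 : EuclideanSpace ℝ (Fin n)) ∈ interior L)
    {u : EuclideanSpace ℝ (Fin n)} (hu : u ≠ 0) : 0 < supportFun L u := by
  have hcont : Tendsto (fun r : ℝ => r • u) (nhdsWithin 0 (Ioi 0)) (nhds 0) := by
    have : Tendsto (fun r : ℝ => r • u) (nhds 0) (nhds ((0 : ℝ) • u)) :=
      (continuous_id.smul continuous_const).tendsto 0
    rw [zero_smul] at this
    exact this.mono_left nhdsWithin_le_nhds
  obtain ⟨r, hrL, hr⟩ := ((hcont.eventually (isOpen_interior.mem_nhds h0)).and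
    self_mem_nhdsWithin).exists
  refine lt_of_lt_of_le ?_ (inner_le_supportFun hL (interior_subset hrL) u)
  rw [real_inner_smul_left, real_inner_self_eq_norm_sq]
  have : 0 < ‖u‖ := norm_pos_iff.2 hu
  have hr' : 0 < r := hr
  positivity

theorem zero_mem_interior (hconv : Convex ℝ L) (hint : (interior L).Nonempty) (hsymm : -L = L) :
    (0 : EuclideanSpace ℝ (Fin n)) ∈ interior L := by
  obtain ⟨x, hx⟩ := hint
  have hx' : -x ∈ interior L := by
    have : interior L = -interior L := by
      conv_lhs => rw [← hsymm]
      exact ((Homeomorph.neg (EuclideanSpace ℝ (Fin n))).preimage_interior L).symm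
    rw [this]
    simpa using hx
  have := hconv.interior hx hx' (a := 1 / 2) (b := 1 / 2) (by norm_num) (by norm_num) (by norm_num)
  simpa using this

theorem inner_le_gauge_mul_supportFun (hL : IsCompact L)
    (h0 : (0 : EuclideanSpace ℝ (Fin n)) ∈ interior L) (x u : EuclideanSpace ℝ (Fin n)) :
    inner ℝ x u ≤ gauge L x * supportFun L u := by
  have habs : Absorbent ℝ L := absorbent_nhds_zero (mem_interior_iff_mem_nhds.1 h0)
  have hu : 0 ≤ supportFun L u := by
    simpa using inner_le_supportFun hL (interior_subset h0) u
  refine le_of_forall_pos_le_add fun δ hδ => ?_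
  -- The gauge is an infimum, so `x` is written as `r • y` with `r` slightly above it; the `+ 1` in
  -- the denominator avoids division by zero.
  obtain ⟨r, hr0, hr, y, hy, hyx⟩ := exists_lt_of_gauge_lt habs
    (show gauge L x < gauge L x + δ / (supportFun L u + 1) by
      have : 0 < δ / (supportFun L u + 1) := by positivity
      linarith)
  have h1 : inner ℝ x u = r * inner ℝ y u := by
    rw [← hyx]; exact real_inner_smul_left _ _ _
  rw [h1]
  calc r * inner ℝ y u ≤ r * supportFun L u := by
        gcongr; exact inner_le_supportFun hL hy u
    _ ≤ (gauge L x + δ / (supportFun L u + 1)) * supportFun L u := by gcongr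
    _ = gauge L x * supportFun L u + δ * (supportFun L u / (supportFun L u + 1)) := by ring
    _ ≤ gauge L x * supportFun L u + δ * 1 := by
        gcongr
        exact div_le_one_of_le₀ (by linarith) (by positivity)
    _ = _ := by ring

/-- Blaschke–Santaló inequality for an origin-symmetric convex body and its polar body. -/
theorem volume_mul_volume_polar_le (hn : 1 ≤ n) (hL : IsCompact L) (hconv : Convex ℝ L)
    (hint : (interior L).Nonempty) (hsymm : -L = L) :
    volume L * volume {u | supportFun L u < 1} ≤
      volume (Metric.ball (0 : EuclideanSpace ℝ (Fin n)) 1) ^ 2 := by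
  have h0 := zero_mem_interior hconv hint hsymm
  have hne : L.Nonempty := ⟨0, interior_subset h0⟩
  have hnhds : L ∈ nhds 0 := mem_interior_iff_mem_nhds.1 h0
  have habs : Absorbent ℝ L := absorbent_nhds_zero hnhds
  have hneg : ∀ x ∈ L, -x ∈ L := fun x hx => by
    rw [← hsymm]; simpa using hx
  have hLle : volume L ≤ volume {x | gauge L x < 1} := by
    -- The frontier of a convex set is null, so the closed body may be replaced by its interior,
    -- which lies in the open unit ball of the gauge.
    have : volume L = volume (interior L) := by
      refine le_antisymm ?_ (measure_mono interior_subset)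
      have h1 : L ⊆ interior L ∪ frontier L := by
        rw [← closure_eq_interior_union_frontier]; exact subset_closure
      refine (measure_mono h1).trans ((measure_union_le _ _).trans ?_)
      rw [hconv.addHaar_frontier volume, add_zero]
    rw [this]
    exact measure_mono (interior_subset_gauge_lt_one L)
  refine (mul_le_mul_left hLle _).trans ?_
  have habsr : ∀ (p : EuclideanSpace ℝ (Fin n) → ℝ), (∀ x, p (-x) = p x) →
      (∀ r x, 0 ≤ r → p (r • x) = r * p x) → ∀ r x, p (r • x) ≤ |r| * p x := by
    intro p hp hp' r x
    rcases le_total 0 r with hr | hr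
    · rw [hp' r x hr, abs_of_nonneg hr]
    · rw [← hp, ← neg_smul, hp' (-r) x (by linarith), abs_of_nonpos hr]
  have hgneg : ∀ x, gauge L (-x) = gauge L x := gauge_neg hneg
  refine volume_mul_volume_le hn (continuous_gauge hconv hnhds).measurable
    (continuous_supportFun hL hne).measurable gauge_zero hgneg (gauge_add_le hconv habs)
    (fun {x} => (gauge_eq_zero habs (NormedSpace.isVonNBounded_of_isBounded ℝ hL.isBounded)).1)
    (habsr _ hgneg fun r x hr => by rw [gauge_smul_of_nonneg hr, smul_eq_mul])
    (supportFun_zero hne) (supportFun_neg hsymm) (supportFun_add_le hL hne)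
    (fun {x} hx => ?_) (habsr _ (supportFun_neg hsymm) fun r x hr => supportFun_smul hr x)
    (inner_le_gauge_mul_supportFun hL h0)
  by_contra hcon
  exact (supportFun_pos hL h0 hcon).ne' hx

end SupportFunction

/-! ### The constants `kappa` and `omega`, and negative moments of the support function. -/

instance (n : ℕ) : IsFiniteMeasure (sphereMeasure n) :=
  inferInstanceAs (IsFiniteMeasure (volume : Measure (EuclideanSpace ℝ (Fin n))).toSphere)

theorem kappa_eq_ball {n : ℕ} (hn : 1 ≤ n) :
    kappa n = volume.real (Metric.ball (0 : EuclideanSpace ℝ (Fin n)) 1) := by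
  have : Nonempty (Fin n) := ⟨⟨0, hn⟩⟩
  rw [kappa, measureReal_def, Measure.addHaar_closedBall_eq_addHaar_ball, measureReal_def]

theorem omega_eq_mul_kappa (n : ℕ) : omega n = n * kappa n := by
  rw [omega, sphereMeasure, Measure.toSphere_real_apply_univ, finrank_euclideanSpace,
    Fintype.card_fin]
  rcases Nat.eq_zero_or_pos n with rfl | hn
  · simp
  · rw [kappa_eq_ball hn]

theorem kappa_pos (n : ℕ) : 0 < kappa n :=
  ENNReal.toReal_pos (Metric.measure_closedBall_pos _ _ one_pos).ne'
    measure_closedBall_lt_top.ne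

theorem omega_pos {n : ℕ} (hn : 1 ≤ n) : 0 < omega n := by
  have h1 := kappa_pos n
  have h2 : (0 : ℝ) < n := by exact_mod_cast hn
  rw [omega_eq_mul_kappa]
  positivity

theorem ne_zero_of_sphere {n : ℕ} (u : Metric.sphere (0 : EuclideanSpace ℝ (Fin n)) 1) :
    (u : EuclideanSpace ℝ (Fin n)) ≠ 0 := by
  intro h0
  have := u.2
  rw [mem_sphere_zero_iff_norm, h0] at this
  simp at this

section Santalo

variable {n : ℕ} {L : Set (EuclideanSpace ℝ (Fin n))}

theorem integrable_of_continuous_sphere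
    {f : Metric.sphere (0 : EuclideanSpace ℝ (Fin n)) 1 → ℝ} (hf : Continuous f) :
    Integrable f (sphereMeasure n) := by
  have := isCompact_iff_compactSpace.1 (isCompact_sphere (0 : EuclideanSpace ℝ (Fin n)) 1)
  exact hf.integrable_of_hasCompactSupport (HasCompactSupport.of_compactSpace f)

theorem continuous_inv_supportFun (hL : IsCompact L)
    (h0 : (0 : EuclideanSpace ℝ (Fin n)) ∈ interior L) :
    Continuous fun u : Metric.sphere (0 : EuclideanSpace ℝ (Fin n)) 1 => (supportFun L u)⁻¹ :=
  ((continuous_supportFun hL ⟨0, interior_subset h0⟩).comp continuous_subtype_val).inv₀ fun u =>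
    (supportFun_pos hL h0 (ne_zero_of_sphere u)).ne'

/-- The `L_{-n}`-width of an origin-symmetric body with the volume of the unit ball is at most
that of the ball. -/
theorem integral_inv_supportFun_pow_le (hn : 1 ≤ n) (hL : IsCompact L) (hconv : Convex ℝ L)
    (hint : (interior L).Nonempty) (hsymm : -L = L) (hvol : volume.real L = kappa n) :
    ∫ u, (supportFun L u)⁻¹ ^ n ∂sphereMeasure n ≤ omega n := by
  have h0 := zero_mem_interior hconv hint hsymm
  have hne : L.Nonempty := ⟨0, interior_subset h0⟩
  have hn' : (0 : ℝ) < n := by exact_mod_cast hn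
  have hφ := continuous_inv_supportFun hL h0
  have hpos : ∀ u : Metric.sphere (0 : EuclideanSpace ℝ (Fin n)) 1, 0 < (supportFun L u)⁻¹ :=
    fun u => inv_pos.2 (supportFun_pos hL h0 (ne_zero_of_sphere u))
  have hS := volume_mul_volume_polar_le hn hL hconv hint hsymm
  have hP := volume_lt_one_eq_lintegral_sphere hn (continuous_supportFun hL hne).measurable
    (fun x hx => supportFun_pos hL h0 hx) (fun r x hr => supportFun_smul hr x)
  have hφn : Continuous fun u : Metric.sphere (0 : EuclideanSpace ℝ (Fin n)) 1 =>
      (supportFun L u)⁻¹ ^ n / n := (hφ.pow n).div_const _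
  rw [← ofReal_integral_eq_lintegral_ofReal (integrable_of_continuous_sphere hφn)
    (.of_forall fun u => by have := hpos u; positivity), integral_div] at hP
  have hI : 0 ≤ ∫ u, (supportFun L u)⁻¹ ^ n ∂sphereMeasure n :=
    integral_nonneg fun u => by have := hpos u; positivity
  have h1 := ENNReal.toReal_mono (ENNReal.pow_ne_top measure_ball_lt_top.ne) hS
  have hb : (volume (Metric.ball (0 : EuclideanSpace ℝ (Fin n)) 1)).toReal = kappa n :=
    (kappa_eq_ball hn).symm
  rw [toReal_mul, toReal_pow, hb, ← measureReal_def, hvol, hP, toReal_ofReal (by positivity),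
    sq] at h1
  have h2 := le_of_mul_le_mul_left h1 (kappa_pos n)
  rw [div_le_iff₀ hn'] at h2
  rw [omega_eq_mul_kappa]
  linarith

theorem supportFun_eq_of_dim_one {L : Set (EuclideanSpace ℝ (Fin 1))} (hsymm : -L = L)
    (u v : Metric.sphere (0 : EuclideanSpace ℝ (Fin 1)) 1) : supportFun L u = supportFun L v := by
  have key : ∀ w : Metric.sphere (0 : EuclideanSpace ℝ (Fin 1)) 1,
      |(w : EuclideanSpace ℝ (Fin 1)) 0| = 1 := by
    intro w
    have := mem_sphere_zero_iff_norm.1 w.2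
    rw [EuclideanSpace.norm_eq] at this
    simpa [Real.sqrt_sq_eq_abs] using this
  have : (u : EuclideanSpace ℝ (Fin 1)) = v ∨ (u : EuclideanSpace ℝ (Fin 1)) = -v := by
    rcases abs_eq_abs.1 ((key u).trans (key v).symm) with h | h
    · left; ext i; fin_cases i; exact h
    · right; ext i; fin_cases i; exact h
  rcases this with h | h
  · rw [h]
  · rw [h, supportFun_neg hsymm]

/-- For `n ≥ 2`, Bernoulli's inequality with exponent `n / 2` at `h⁻²` gives the power-mean
comparison with `∫ h⁻ⁿ`. For `n = 1` the sphere has two antipodal points, `h` is constant, and the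
first moment already forces `h⁻¹ ≤ 1`. -/
theorem integral_inv_supportFun_sq_le (hn : 1 ≤ n) (hL : IsCompact L) (hconv : Convex ℝ L)
    (hint : (interior L).Nonempty) (hsymm : -L = L) (hvol : volume.real L = kappa n) :
    ∫ u, (supportFun L u)⁻¹ ^ 2 ∂sphereMeasure n ≤ omega n := by
  have hS := integral_inv_supportFun_pow_le hn hL hconv hint hsymm hvol
  have h0 := zero_mem_interior hconv hint hsymm
  have hφ := continuous_inv_supportFun hL h0
  have hpos : ∀ u : Metric.sphere (0 : EuclideanSpace ℝ (Fin n)) 1, 0 < (supportFun L u)⁻¹ :=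
    fun u => inv_pos.2 (supportFun_pos hL h0 (ne_zero_of_sphere u))
  rcases hn.eq_or_lt with rfl | hn2
  · have hle : ∀ u : Metric.sphere (0 : EuclideanSpace ℝ (Fin 1)) 1, (supportFun L u)⁻¹ ≤ 1 := by
      intro v
      have hc : ∀ u : Metric.sphere (0 : EuclideanSpace ℝ (Fin 1)) 1,
          (supportFun L u)⁻¹ ^ 1 = (supportFun L v)⁻¹ := fun u => by
        rw [pow_one, supportFun_eq_of_dim_one hsymm u v]
      simp_rw [hc] at hS
      rw [integral_const, smul_eq_mul] at hS
      have : omega 1 * (supportFun L v)⁻¹ ≤ omega 1 * 1 := by rw [mul_one]; exact hS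
      exact le_of_mul_le_mul_left this (omega_pos le_rfl)
    refine (integral_mono (integrable_of_continuous_sphere (hφ.pow 2))
      (integrable_of_continuous_sphere (hφ.pow 1)) fun u => ?_).trans hS
    exact pow_le_pow_of_le_one (hpos u).le (hle u) one_le_two
  · have hpt : ∀ u : Metric.sphere (0 : EuclideanSpace ℝ (Fin n)) 1,
        1 + (n / 2 : ℝ) * ((supportFun L u)⁻¹ ^ 2 - 1) ≤ (supportFun L u)⁻¹ ^ n := by
      intro u
      have hn2' : (2 : ℝ) ≤ n := by exact_mod_cast hn2
      have := one_add_mul_self_le_rpow_one_add (s := (supportFun L u)⁻¹ ^ 2 - 1)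
        (by have := hpos u; nlinarith [sq_nonneg (supportFun L u)⁻¹]) (p := n / 2) (by linarith)
      rw [add_sub_cancel, ← Real.rpow_natCast (supportFun L u)⁻¹ 2, ← Real.rpow_mul (hpos u).le] at this
      rw [Nat.cast_ofNat, mul_div_cancel₀ _ (two_ne_zero), Real.rpow_natCast, Real.rpow_ofNat] at this
      exact this
    have i2 : Integrable (fun u : Metric.sphere (0 : EuclideanSpace ℝ (Fin n)) 1 =>
        (supportFun L u)⁻¹ ^ 2) (sphereMeasure n) := integrable_of_continuous_sphere (hφ.pow 2)
    have i3 : Integrable (fun u : Metric.sphere (0 : EuclideanSpace ℝ (Fin n)) 1 =>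
        (n / 2 : ℝ) * ((supportFun L u)⁻¹ ^ 2 - 1)) (sphereMeasure n) :=
      (i2.sub (integrable_const 1)).const_mul _
    have h1 := (integral_mono ((integrable_const 1).add i3)
      (integrable_of_continuous_sphere (hφ.pow n)) hpt).trans hS
    simp only [Pi.add_apply] at h1
    rw [integral_add (integrable_const _) i3,
      integral_const_mul, integral_sub i2 (integrable_const 1)] at h1
    simp only [integral_const, smul_eq_mul, mul_one] at h1
    change omega n + (n / 2 : ℝ) * (_ - omega n) ≤ omega n at h1
    have hn' : (0 : ℝ) < n / 2 := by positivity
    by_contra! hcon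
    have := mul_pos hn' (sub_pos.2 hcon)
    linarith

end Santalo

/-! ### Measure of an equatorial band of the sphere. -/

section Cap

theorem measurableSet_cylinder (m : ℕ) (t : ℝ) : MeasurableSet
    {y : EuclideanSpace ℝ (Fin (m + 1)) | |y 0| ≤ t ∧ ∑ i : Fin m, y i.succ ^ 2 < 1} := by
  have h1 : MeasurableSet {y : EuclideanSpace ℝ (Fin (m + 1)) | |y 0| ≤ t} :=
    measurableSet_le (by fun_prop) measurable_const
  have h2 : MeasurableSet {y : EuclideanSpace ℝ (Fin (m + 1)) | ∑ i : Fin m, y i.succ ^ 2 < 1} :=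
    measurableSet_lt (by fun_prop) measurable_const
  exact h1.inter h2

theorem volume_cylinder (m : ℕ) (t : ℝ) :
    volume {y : EuclideanSpace ℝ (Fin (m + 1)) | |y 0| ≤ t ∧ ∑ i : Fin m, y i.succ ^ 2 < 1} =
      .ofReal (2 * t) * volume (Metric.ball (0 : EuclideanSpace ℝ (Fin m)) 1) := by
  have hB : Metric.ball (0 : EuclideanSpace ℝ (Fin m)) 1 = {z | ∑ i, z i ^ 2 < 1} := by
    rw [EuclideanSpace.ball_zero_eq _ zero_le_one, one_pow]
  rw [hB, ← (PiLp.volume_preserving_toLp (Fin m)).measure_preimage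
      (measurableSet_lt (by fun_prop) measurable_const).nullMeasurableSet,
    ← (PiLp.volume_preserving_toLp (Fin (m + 1))).measure_preimage
      (measurableSet_cylinder m t).nullMeasurableSet,
    ← ((volume_preserving_piFinSuccAbove (fun _ : Fin (m + 1) => ℝ) 0).symm _).measure_preimage_equiv]
  have : ((MeasurableEquiv.piFinSuccAbove (fun _ : Fin (m + 1) => ℝ) 0).symm ⁻¹'
      (WithLp.toLp 2 ⁻¹' {y : EuclideanSpace ℝ (Fin (m + 1)) |
        |y 0| ≤ t ∧ ∑ i : Fin m, y i.succ ^ 2 < 1})) =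
      Icc (-t) t ×ˢ (WithLp.toLp 2 ⁻¹' {z : EuclideanSpace ℝ (Fin m) | ∑ i, z i ^ 2 < 1}) := by
    ext X
    simp [MeasurableEquiv.piFinSuccAbove, abs_le]
  rw [this, Measure.volume_eq_prod, Measure.prod_prod, Real.volume_Icc]
  congr 2
  ring

/-- A symmetric spherical band has at most the measure given by the cylinder that contains the cone
over it. -/
theorem sphereMeasure_band_le (m : ℕ) (hm : 1 ≤ m) {e : EuclideanSpace ℝ (Fin (m + 1))}
    (he : ‖e‖ = 1) {t : ℝ} (ht : 0 ≤ t) :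
    (sphereMeasure (m + 1)).real {u | |inner ℝ e (u : EuclideanSpace ℝ (Fin (m + 1)))| ≤ t} ≤
      4 * t * omega m := by
  set e₀ : EuclideanSpace ℝ (Fin (m + 1)) := EuclideanSpace.single 0 1 with he₀
  have hn : ‖e‖ = ‖e₀‖ := by rw [he, he₀]; simp
  set T := (Submodule.span ℝ {e - e₀})ᗮ.reflection with hT
  -- The reflection exchanging two vectors of equal norm moves the axis of the band to the first
  -- coordinate axis.
  have hTe : T e = e₀ := Submodule.reflection_sub hn
  set A : Set (Metric.sphere (0 : EuclideanSpace ℝ (Fin (m + 1))) 1) :=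
    {u | |inner ℝ e (u : EuclideanSpace ℝ (Fin (m + 1)))| ≤ t} with hA
  have hAm : MeasurableSet A := (isClosed_le (by fun_prop) continuous_const).measurableSet
  set Cyl : Set (EuclideanSpace ℝ (Fin (m + 1))) :=
    {y | |y 0| ≤ t ∧ ∑ i : Fin m, y i.succ ^ 2 < 1} with hCyl
  have hsub : Ioo (0 : ℝ) 1 • (Subtype.val '' A) ⊆ T ⁻¹' Cyl := by
    rintro _ ⟨r, hr, _, ⟨u, hu, rfl⟩, rfl⟩
    have hu1 : ‖(u : EuclideanSpace ℝ (Fin (m + 1)))‖ = 1 := mem_sphere_zero_iff_norm.1 u.2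
    have hTu : (T u) 0 = inner ℝ e (u : EuclideanSpace ℝ (Fin (m + 1))) := by
      rw [← T.inner_map_map, hTe, he₀, EuclideanSpace.inner_single_left]
      simp
    have hr0 : 0 < r := hr.1
    have hr1 : r < 1 := hr.2
    have hnorm : ∑ i, (T u) i ^ 2 = 1 := by
      rw [← EuclideanSpace.real_norm_sq_eq, T.norm_map, hu1, one_pow]
    rw [Fin.sum_univ_succ] at hnorm
    simp only [mem_preimage, smul_eq_mul, map_smul, hCyl, mem_ofPred_eq, PiLp.smul_apply]
    refine ⟨?_, ?_⟩
    · rw [abs_mul, abs_of_pos hr0, hTu]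
      have : |inner ℝ e (u : EuclideanSpace ℝ (Fin (m + 1)))| ≤ t := hu
      nlinarith [abs_nonneg (inner ℝ e (u : EuclideanSpace ℝ (Fin (m + 1))))]
    · simp only [mul_pow]
      rw [← Finset.mul_sum]
      nlinarith [sq_nonneg ((T u) 0), sq_nonneg r]
  have h1 : sphereMeasure (m + 1) A ≤
      ((m + 1 : ℕ) : ℝ≥0∞) * (.ofReal (2 * t) * volume (Metric.ball (0 : EuclideanSpace ℝ (Fin m)) 1)) := by
    rw [sphereMeasure, Measure.toSphere_apply' _ hAm, finrank_euclideanSpace, Fintype.card_fin,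
      ← volume_cylinder]
    refine mul_le_mul' le_rfl ((measure_mono hsub).trans_eq ?_)
    exact T.measurePreserving.measure_preimage
      (measurableSet_cylinder m t).nullMeasurableSet
  have h2 := ENNReal.toReal_mono (ENNReal.mul_ne_top (by simp)
    (ENNReal.mul_ne_top ofReal_ne_top measure_ball_lt_top.ne)) h1
  have hb : (volume (Metric.ball (0 : EuclideanSpace ℝ (Fin m)) 1)).toReal = kappa m :=
    (kappa_eq_ball hm).symm
  rw [toReal_mul, toReal_mul, toReal_natCast, hb, toReal_ofReal (by positivity),
    ← measureReal_def] at h2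
  refine h2.trans ?_
  rw [omega_eq_mul_kappa]
  -- The cone over the band gives `2 t (m + 1) κ_m`, and `m + 1 ≤ 2 m` turns this into `4 t ω_m`.
  have hm' : (1 : ℝ) ≤ m := by exact_mod_cast hm
  have := mul_nonneg ht (kappa_pos m).le
  push_cast
  nlinarith

end Cap

/-! ### The stability estimate and the diameter bound. -/

section Stability

variable {n : ℕ} {L : Set (EuclideanSpace ℝ (Fin n))}

theorem lpWidth_neg_one_le (h0 : (0 : EuclideanSpace ℝ (Fin n)) ∈ interior L) (hL : IsCompact L) :
    lpWidth (-1) L ≤ 1 / omega n * ∫ u, (supportFun L u)⁻¹ ∂sphereMeasure n := by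
  have hom : 0 ≤ omega n := measureReal_nonneg
  unfold lpWidth
  -- The lower bound 0 has to be supplied, since a real `sInf` is meaningful only for sets bounded
  -- below.
  refine mul_le_mul_of_nonneg_left (csInf_le ⟨0, ?_⟩ ⟨0, h0, ?_⟩) (by positivity)
  · rintro _ ⟨x, hx, rfl⟩
    refine integral_nonneg fun u => Real.rpow_nonneg ?_ _
    have := inner_le_supportFun (hL.image (by fun_prop : Continuous fun y => y - x))
      (mem_image_of_mem _ (interior_subset hx)) u
    simpa using this
  · simp [Real.rpow_neg_one]

theorem norm_le_half_diam (hL : IsCompact L) (hsymm : -L = L) {x : EuclideanSpace ℝ (Fin n)}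
    (hx : x ∈ L) : ‖x‖ ≤ 1 / 2 * Metric.diam L := by
  have hx' : -x ∈ L := by rw [← hsymm]; simpa using hx
  have h1 := Metric.dist_le_diam_of_mem hL.isBounded hx hx'
  rw [dist_eq_norm, sub_neg_eq_add, ← two_smul ℝ x, norm_smul, Real.norm_ofNat] at h1
  linarith

theorem exists_norm_eq_half_diam (hL : IsCompact L) (hne : L.Nonempty) (hsymm : -L = L) :
    ∃ x ∈ L, ‖x‖ = 1 / 2 * Metric.diam L := by
  obtain ⟨x, hx, hmax⟩ := hL.exists_isMaxOn hne continuous_norm.continuousOn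
  refine ⟨x, hx, le_antisymm (norm_le_half_diam hL hsymm hx) ?_⟩
  have : Metric.diam L ≤ 2 * ‖x‖ := Metric.diam_le_of_forall_dist_le (by positivity)
    fun y hy z hz => by
      have h1 : ‖y‖ ≤ ‖x‖ := hmax hy
      have h2 : ‖z‖ ≤ ‖x‖ := hmax hz
      linarith [dist_le_norm_add_norm y z]
  linarith

theorem supportFun_le_half_diam (hL : IsCompact L) (hne : L.Nonempty) (hsymm : -L = L)
    (u : Metric.sphere (0 : EuclideanSpace ℝ (Fin n)) 1) :
    supportFun L u ≤ 1 / 2 * Metric.diam L :=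
  supportFun_le hne fun x hx => by
    have := real_inner_le_norm x (u : EuclideanSpace ℝ (Fin n))
    rw [mem_sphere_zero_iff_norm.1 u.2, mul_one] at this
    exact this.trans (norm_le_half_diam hL hsymm hx)

theorem supportFun_closedBall (u : Metric.sphere (0 : EuclideanSpace ℝ (Fin n)) 1) :
    supportFun (Metric.closedBall 0 1) (u : EuclideanSpace ℝ (Fin n)) = 1 := by
  have hu := mem_sphere_zero_iff_norm.1 u.2
  refine le_antisymm (supportFun_le (Metric.nonempty_closedBall.2 zero_le_one) fun x hx => ?_) ?_
  · have := real_inner_le_norm x (u : EuclideanSpace ℝ (Fin n))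
    rw [hu, mul_one] at this
    exact this.trans (by simpa using hx)
  · have := inner_le_supportFun (isCompact_closedBall (0 : EuclideanSpace ℝ (Fin n)) 1)
      (show (u : EuclideanSpace ℝ (Fin n)) ∈ _ by simp [hu]) u
    rwa [real_inner_self_eq_norm_sq, hu, one_pow] at this

variable (hn : 1 ≤ n) (hL : IsCompact L) (hconv : Convex ℝ L) (hint : (interior L).Nonempty)
  (hsymm : -L = L) (hvol : volume.real L = kappa n) {ε : ℝ}
  (hε : (1 - ε) * omega n ≤ ∫ u, (supportFun L u)⁻¹ ∂sphereMeasure n)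

include hn hL hconv hint hsymm hvol hε

/-- Expanding `(h - 1)² = h² (1 - 2 h⁻¹ + h⁻²)`, bounding `h` by half the diameter and inserting the
two moment bounds gives `δ₂² ≤ D² ε / 2`, better than needed by a factor 2. -/
theorem deltaTwo_closedBall_le (hε0 : 0 < ε) :
    deltaTwo L (Metric.closedBall 0 1) ≤ Metric.diam L * Real.sqrt ε := by
  have h0 := zero_mem_interior hconv hint hsymm
  have hne : L.Nonempty := ⟨0, interior_subset h0⟩
  have hφ := continuous_inv_supportFun hL h0
  have hh : Continuous fun u : Metric.sphere (0 : EuclideanSpace ℝ (Fin n)) 1 => supportFun L u :=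
    (continuous_supportFun hL hne).comp continuous_subtype_val
  have hom := omega_pos hn
  have hD : 0 ≤ Metric.diam L := Metric.diam_nonneg
  have hsq := integral_inv_supportFun_sq_le hn hL hconv hint hsymm hvol
  set H := 1 / 2 * Metric.diam L with hH
  have i1 : Integrable (fun u : Metric.sphere (0 : EuclideanSpace ℝ (Fin n)) 1 =>
      (supportFun L u)⁻¹) (sphereMeasure n) := integrable_of_continuous_sphere hφ
  have i2 : Integrable (fun u : Metric.sphere (0 : EuclideanSpace ℝ (Fin n)) 1 =>
      (supportFun L u)⁻¹ ^ 2) (sphereMeasure n) := integrable_of_continuous_sphere (hφ.pow 2)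
  have i3 : Integrable (fun u : Metric.sphere (0 : EuclideanSpace ℝ (Fin n)) 1 =>
      1 - 2 * (supportFun L u)⁻¹) (sphereMeasure n) := (integrable_const 1).sub (i1.const_mul 2)
  have hpt : ∀ u : Metric.sphere (0 : EuclideanSpace ℝ (Fin n)) 1,
      |supportFun L u - supportFun (Metric.closedBall 0 1) (u : EuclideanSpace ℝ (Fin n))| ^ 2 ≤
        H ^ 2 * (1 - 2 * (supportFun L u)⁻¹ + (supportFun L u)⁻¹ ^ 2) := by
    intro u
    have hu := supportFun_pos hL h0 (ne_zero_of_sphere u)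
    have hle := supportFun_le_half_diam hL hne hsymm u
    rw [supportFun_closedBall, sq_abs]
    have e : (supportFun L u - 1) ^ 2 =
        supportFun L u ^ 2 * (1 - 2 * (supportFun L u)⁻¹ + (supportFun L u)⁻¹ ^ 2) := by
      field_simp
      ring
    rw [e]
    have : 0 ≤ 1 - 2 * (supportFun L u)⁻¹ + (supportFun L u)⁻¹ ^ 2 := by
      nlinarith [sq_nonneg (1 - (supportFun L u)⁻¹)]
    gcongr
  have hI : ∫ u : Metric.sphere (0 : EuclideanSpace ℝ (Fin n)) 1,
      |supportFun L u - supportFun (Metric.closedBall 0 1) (u : EuclideanSpace ℝ (Fin n))| ^ 2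
        ∂sphereMeasure n ≤
      H ^ 2 * (2 * ε * omega n) := by
    refine (integral_mono (integrable_of_continuous_sphere ?_) ((i3.add i2).const_mul (H ^ 2))
      hpt).trans ?_
    · simp_rw [supportFun_closedBall]
      fun_prop
    · simp only [Pi.add_apply]
      rw [integral_const_mul, integral_add i3 i2, integral_sub (integrable_const 1) (i1.const_mul 2),
        integral_const_mul]
      simp only [integral_const, smul_eq_mul, mul_one]
      change H ^ 2 * (omega n - _ + _) ≤ _
      gcongr
      linarith
  unfold deltaTwo
  refine Real.sqrt_le_iff.2 ⟨by positivity, ?_⟩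
  rw [mul_pow, Real.sq_sqrt hε0.le, one_div, inv_mul_le_iff₀ hom]
  refine hI.trans ?_
  rw [hH]
  nlinarith [mul_nonneg (mul_nonneg (sq_nonneg (Metric.diam L)) hε0.le) hom.le]

/-- With `a = H ^ (1 / 3)`, the sphere is split at the band where `H |⟪e, u⟫| ≤ a`. Off the band
`h⁻¹ ≤ a⁻¹`; on it Young's inequality trades `h⁻¹` for `h⁻²` and the measure of the band. Both
contributions are of order `a⁻¹`. -/
theorem half_diam_rpow_le (hε0 : 0 < ε) (hε1 : ε < 1) :
    (1 / 2 * Metric.diam L) ^ (1 / 3 : ℝ) ≤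
      (1 + (4 * omega (n - 1) / omega n) ^ (1 / 2 : ℝ)) * (1 / (1 - ε)) := by
  have h0 := zero_mem_interior hconv hint hsymm
  have hne : L.Nonempty := ⟨0, interior_subset h0⟩
  have hφ := continuous_inv_supportFun hL h0
  have hom := omega_pos hn
  have hsq := integral_inv_supportFun_sq_le hn hL hconv hint hsymm hvol
  obtain ⟨x₀, hx₀, hx₀n⟩ := exists_norm_eq_half_diam hL hne hsymm
  set H := 1 / 2 * Metric.diam L with hH
  have hx₀' : -x₀ ∈ L := by rw [← hsymm]; simpa using hx₀
  have hlow : ∀ u : EuclideanSpace ℝ (Fin n), |inner ℝ x₀ u| ≤ supportFun L u := by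
    intro u
    refine abs_le'.2 ⟨inner_le_supportFun hL hx₀ u, ?_⟩
    rw [← inner_neg_left]
    exact inner_le_supportFun hL hx₀' u
  have i1 : Integrable (fun u : Metric.sphere (0 : EuclideanSpace ℝ (Fin n)) 1 =>
      (supportFun L u)⁻¹) (sphereMeasure n) := integrable_of_continuous_sphere hφ
  have i2 : Integrable (fun u : Metric.sphere (0 : EuclideanSpace ℝ (Fin n)) 1 =>
      (supportFun L u)⁻¹ ^ 2) (sphereMeasure n) := integrable_of_continuous_sphere (hφ.pow 2)
  have hHpos : 0 < H := by
    let u₀ : EuclideanSpace ℝ (Fin n) := EuclideanSpace.single ⟨0, hn⟩ 1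
    have hu₀ : u₀ ∈ Metric.sphere (0 : EuclideanSpace ℝ (Fin n)) 1 := by simp [u₀]
    exact (supportFun_pos hL h0 (ne_zero_of_sphere ⟨u₀, hu₀⟩)).trans_le
      (supportFun_le_half_diam hL hne hsymm ⟨u₀, hu₀⟩)
  set a := H ^ (1 / 3 : ℝ) with ha
  have ha0 : 0 < a := Real.rpow_pos_of_pos hHpos _
  have ha3 : a ^ 3 = H := by
    rw [ha, ← Real.rpow_natCast, ← Real.rpow_mul hHpos.le]
    norm_num
  set e : EuclideanSpace ℝ (Fin n) := H⁻¹ • x₀ with he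
  have he1 : ‖e‖ = 1 := by
    rw [he, norm_smul, hx₀n, norm_inv, Real.norm_of_nonneg hHpos.le, inv_mul_cancel₀ hHpos.ne']
  have hlow' : ∀ u : EuclideanSpace ℝ (Fin n), H * |inner ℝ e u| ≤ supportFun L u := by
    intro u
    refine le_trans (le_of_eq ?_) (hlow u)
    rw [he, real_inner_smul_left, abs_mul, abs_of_pos (inv_pos.2 hHpos), mul_inv_cancel_left₀ hHpos.ne']
  rw [← Real.sqrt_eq_rpow, mul_one_div, le_div_iff₀ (by linarith)]
  -- In dimension one the band estimate does not apply, but `h` is the constant `H`, and only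
  -- nonnegativity of the square-root term is needed.
  rcases hn.eq_or_lt with rfl | hn2
  · have hle : ∀ u : Metric.sphere (0 : EuclideanSpace ℝ (Fin 1)) 1, (supportFun L u)⁻¹ ≤ H⁻¹ := by
      intro u
      rw [supportFun_eq_of_dim_one hsymm u ⟨e, by simp [he1]⟩]
      refine inv_anti₀ hHpos ?_
      have := hlow' e
      rwa [real_inner_self_eq_norm_sq, he1, one_pow, abs_one, mul_one] at this
    have hI := hε.trans (integral_mono i1 (integrable_const H⁻¹) hle)
    rw [integral_const, smul_eq_mul] at hI
    change _ ≤ omega 1 * H⁻¹ at hI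
    rw [mul_comm] at hI
    have h1 := le_of_mul_le_mul_left hI hom
    rw [← one_div, le_div_iff₀ hHpos, ← ha3] at h1
    have h2 : a * (1 - ε) ≤ 1 := by
      rcases le_total a 1 with h | h
      · nlinarith
      · have : a ≤ a ^ 3 := le_self_pow₀ h (by norm_num)
        nlinarith
    have := Real.sqrt_nonneg (4 * omega (1 - 1) / omega 1)
    linarith
  · obtain ⟨m, rfl⟩ : ∃ m, n = m + 1 := ⟨n - 1, by omega⟩
    have hm : 1 ≤ m := by omega
    rw [Nat.add_sub_cancel]
    have hom' := omega_pos hm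
    set c := 4 * omega m / omega (m + 1) with hc
    have hc0 : 0 < c := by positivity
    -- Chosen so that `H * t = a`.
    set t := (a ^ 2)⁻¹ with ht
    have ht0 : 0 < t := by positivity
    have hband := sphereMeasure_band_le m hm he1 ht0.le
    set A : Set (Metric.sphere (0 : EuclideanSpace ℝ (Fin (m + 1))) 1) :=
      {u | |inner ℝ e (u : EuclideanSpace ℝ (Fin (m + 1)))| ≤ t} with hA
    have hAm : MeasurableSet A := (isClosed_le (by fun_prop) continuous_const).measurableSet
    -- This weight balances Young's inequality: the band term and the `h⁻²` term are each at most `ω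
    -- * lam / 2`.
    set lam := Real.sqrt c / a with hlam
    have hlam0 : 0 < lam := by positivity
    have hlam2 : lam ^ 2 = c * t := by
      rw [hlam, div_pow, Real.sq_sqrt hc0.le, ht, div_eq_mul_inv]
    have hpt : ∀ u : Metric.sphere (0 : EuclideanSpace ℝ (Fin (m + 1))) 1,
        (supportFun L u)⁻¹ ≤ a⁻¹ + lam / 2 * (supportFun L u)⁻¹ ^ 2 +
          A.indicator (fun _ => 1 / (2 * lam)) u := by
      intro u
      have hu := supportFun_pos hL h0 (ne_zero_of_sphere u)
      by_cases huA : u ∈ A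
      · rw [indicator_of_mem huA]
        have h1 : 0 ≤ (lam * (supportFun L u)⁻¹ - 1) ^ 2 / (2 * lam) := by positivity
        have h2 : (lam * (supportFun L u)⁻¹ - 1) ^ 2 / (2 * lam) =
            lam / 2 * (supportFun L u)⁻¹ ^ 2 - (supportFun L u)⁻¹ + 1 / (2 * lam) := by
          field_simp
          ring
        have : 0 < a⁻¹ := by positivity
        linarith
      · rw [indicator_of_notMem huA, add_zero]
        have h1 : t < |inner ℝ e (u : EuclideanSpace ℝ (Fin (m + 1)))| := not_le.1 huA
        have h2 : a ≤ supportFun L u := by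
          refine le_trans ?_ (hlow' u)
          have : a = H * t := by
            rw [ht, ← ha3]; field_simp
          rw [this]
          gcongr
        have h3 := inv_anti₀ ha0 h2
        have : 0 ≤ lam / 2 * (supportFun L u)⁻¹ ^ 2 := by positivity
        linarith
    have iA : Integrable (A.indicator fun _ => 1 / (2 * lam)) (sphereMeasure (m + 1)) :=
      (integrable_const _).indicator hAm
    have i3 : Integrable (fun u : Metric.sphere (0 : EuclideanSpace ℝ (Fin (m + 1))) 1 =>
      a⁻¹ + lam / 2 * (supportFun L u)⁻¹ ^ 2) (sphereMeasure (m + 1)) :=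
      (integrable_const _).add (i2.const_mul _)
    have hI := hε.trans (integral_mono i1 (i3.add iA) hpt)
    simp only [Pi.add_apply] at hI
    rw [integral_add i3 iA, integral_add (integrable_const _) (i2.const_mul _), integral_const_mul,
      integral_indicator_const _ hAm, integral_const, smul_eq_mul, smul_eq_mul] at hI
    change _ ≤ omega (m + 1) * a⁻¹ + _ + _ at hI
    have h4 : (sphereMeasure (m + 1)).real A * (1 / (2 * lam)) ≤ omega (m + 1) * (lam / 2) := by
      have : 4 * t * omega m = lam ^ 2 * omega (m + 1) := by
        rw [hlam2, hc]; field_simp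
      rw [mul_one_div, div_le_iff₀ (by positivity)]
      calc _ ≤ _ := hband
        _ = _ := by rw [this]; ring
    have h5 : lam / 2 * ∫ u, (supportFun L u)⁻¹ ^ 2 ∂sphereMeasure (m + 1) ≤
        lam / 2 * omega (m + 1) := by gcongr
    have h6 : omega (m + 1) * (1 - ε) ≤ omega (m + 1) * (a⁻¹ + lam) := by linarith
    have h7 := le_of_mul_le_mul_left h6 hom
    calc a * (1 - ε) ≤ a * (a⁻¹ + lam) := by gcongr
      _ = 1 + Real.sqrt c := by rw [hlam]; field_simp

end Stability

end LpStability

open LpStability in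
theorem mainTheorem7 (n : ℕ) (hn : 1 ≤ n)
    (K : ConvexBody (EuclideanSpace ℝ (Fin n)))
    (hint : (interior (K : Set (EuclideanSpace ℝ (Fin n)))).Nonempty)
    (hsymm : -(K : Set (EuclideanSpace ℝ (Fin n))) = K)
    (ε : ℝ) (hε0 : 0 < ε) (hε1 : ε < 1)
    (hwidth : 1 - ε ≤ LpStability.lpWidth (-1) (LpStability.normalize (K : Set (EuclideanSpace ℝ (Fin n))))) :
    (∃ r : ℝ, 1 ≤ r ∧ r ≤ (1 - ε)⁻¹ ∧
      LpStability.deltaTwo (LpStability.normalize (K : Set (EuclideanSpace ℝ (Fin n))))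
          (Metric.closedBall 0 r)
        ≤ Metric.diam (LpStability.normalize (K : Set (EuclideanSpace ℝ (Fin n)))) * Real.sqrt ε) ∧
    (1 / 2 * Metric.diam (LpStability.normalize (K : Set (EuclideanSpace ℝ (Fin n))))) ^ (1 / 3 : ℝ)
      ≤ (1 + (4 * LpStability.omega (n - 1) / LpStability.omega n) ^ (1 / 2 : ℝ)) * (1 / (1 - ε)) := by
  have hvol := volume_normalize hn K hint
  have hKvol : 0 < volume.real (K : Set (EuclideanSpace ℝ (Fin n))) :=
    ENNReal.toReal_pos
      (Measure.measure_pos_of_nonempty_interior _ hint).ne' K.isCompact.measure_lt_top.ne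
  have hc : 0 < (kappa n / volume.real (K : Set (EuclideanSpace ℝ (Fin n)))) ^ (1 / (n : ℝ)) :=
    Real.rpow_pos_of_pos (div_pos (kappa_pos n) hKvol) _
  have hL : IsCompact (LpStability.normalize (K : Set (EuclideanSpace ℝ (Fin n)))) :=
    K.isCompact.smul _
  have hconv : Convex ℝ (LpStability.normalize (K : Set (EuclideanSpace ℝ (Fin n)))) :=
    K.convex.smul _
  have hint' : (interior (LpStability.normalize (K : Set (EuclideanSpace ℝ (Fin n))))).Nonempty := by
    unfold LpStability.normalize
    rw [interior_smul₀ hc.ne']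
    exact hint.smul_set
  have hsymm' : -(LpStability.normalize (K : Set (EuclideanSpace ℝ (Fin n)))) =
      LpStability.normalize (K : Set (EuclideanSpace ℝ (Fin n))) := by
    unfold LpStability.normalize
    rw [← Set.smul_set_neg, hsymm]
  have hε := hwidth.trans (lpWidth_neg_one_le (zero_mem_interior hconv hint' hsymm') hL)
  rw [one_div, ← div_eq_inv_mul, le_div_iff₀ (omega_pos hn)] at hε
  -- The radius 1 is admissible for every `ε`.
  exact ⟨⟨1, le_rfl, (one_le_inv₀ (by linarith)).2 (by linarith),
    deltaTwo_closedBall_le hn hL hconv hint' hsymm' hvol hε hε0⟩,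
    half_diam_rpow_le hn hL hconv hint' hsymm' hvol hε hε0 hε1⟩
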